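/- Let $X_t$ be a symmetric one-dimensional Lévy process (started at $0$) with real-valued Lévy–Khintchine exponent $\Psi$, i.e. $\mathbf E e^{i\xi X_t}=e^{-t\Psi(\xi)}$ for $t>0$, $\xi\in\mathbb R$. Suppose that $\Psi'(\xi)>0$ for all $\xi>0$ and that $1/(1+\Psi(\xi))$ is integrable over $\mathbb R$. Fix $\lambda>0$ and put $$\vartheta_\lambda=\arctan\left(\frac1\pi\int_0^\infty\left(\frac{2\lambda}{\lambda^2-\xi^2}-\frac{\Psi'(\lambda)}{\Psi(\lambda)-\Psi(\xi)}\right)d\xi\right),$$ and let $G_\lambda$ be the function in $L^2(\mathbb R)\cap C_0(\mathbb R)$ whose Fourier transform (with the convention $\mathcal F\varphi(\xi)=\int_{-\infty}^\infty e^{i\xi x}\varphi(x)\,dx$) is the integrable function $$\mathcal F G_\lambda(\xi)=\cos\vartheta_\lambda\left(\frac{2\lambda}{\lambda^2-\xi^2}-\frac{\Psi'(\lambda)}{\Psi(\lambda)-\Psi(\xi)}\right),\qquad \xi\ne\pm\lambda;$$ that is, $G_\lambda(x)=\frac1{2\pi}\int_{-\infty}^\infty e^{-i\xi x}\mathcal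 F G_\lambda(\xi)\,d\xi$. (a) If $\Psi$ is twice differentiable on $(0,\infty)$ and $2\xi\Psi''(\xi)\le\Psi'(\xi)$ for all $\xi>0$, then $\vartheta_\lambda$ and $G_\lambda$ are well defined (the integral above converges absolutely, and $G_\lambda\in L^2\cap C_0$ has the stated integrable Fourier transform), $\vartheta_\lambda\in[0,\pi/2)$, and $|G_\lambda(x)|\le G_\lambda(0)=\sin\vartheta_\lambda$ for all $x\in\mathbb R$. (b) Suppose that $\Psi(\xi)=\psi(\xi^2)$ for $\xi>0$, where $\psi$ is a complete Bernstein function, i.e. $$\psi(x)=c_1+c_2x+\frac1\pi\int_{(0,\infty)}\frac{x}{x+s}\,\frac{m(ds)}{s},\qquad x>0,$$ with $c_1,c_2\ge0$ and $m$ a Radon measure on $(0,\infty)$ such that $\int\min(s^{-1},s^{-2})\,m(ds)<\infty$. Then $\vartheta_\lambda$ and $G_\lambda$ are well defined in the same sense, $\vartheta_\lambda\in[0,\pi/2)$, $G_\lambda$ is completely monotone on $[0,\infty)$ (continuous on $[0,\infty)$, smooth on $(0,\infty)$, and $(-1)^nG_\lambda^{(n)}\ge0$ on $(0,\infty)$ for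 all $n\ge0$), and there is a finite measure $\gamma_\lambda$ on $[0,\infty)$ such that $G_\lambda(x)=\int_{[0,\infty)}e^{-\xi|x|}\,\gamma_\lambda(d\xi)$ for all $x\in\mathbb R$. In particular $G_\lambda\ge0$; moreover $G_\lambda$ is integrable and $$\int_{-\infty}^\infty G_\lambda(x)\,dx=\mathcal F G_\lambda(0)=\frac{2\cos\vartheta_\lambda}{\lambda}\left(1-\frac{\lambda\Psi'(\lambda)}{2\Psi(\lambda)}\right).$$ If in addition there is a function $\Psi^+$, holomorphic in $\{\operatorname{Re}\xi>0\}$ and continuous in $\{\operatorname{Re}\xi\ge0\}$, with $\Psi^+(\xi)=\Psi(\xi)$ for $\xi>0$ and $\Psi^+(i\xi)\ne\Psi(\lambda)$ for all $\xi>0$, then for all $x\in\mathbb R$ $$G_\lambda(x)=\frac{\Psi'(\lambda)\cos\vartheta_\lambda}{\pi}\int_0^\infty\operatorname{Im}\left(\frac{1}{\Psi(\lambda)-\Psi^+(i\xi)}\right)e^{-\xi|x|}\,d\xi,$$ the integral being absolutely convergent. -/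

import Mathlib

open MeasureTheory ProbabilityTheory Filter Topology Set
open scoped NNReal SchwartzMap

noncomputable section

/-- A one-dimensional Lévy process `X` (started at `0`) on the probability space `(Ω, P)`. -/
structure IsLevyProcess {Ω : Type*} [MeasurableSpace Ω] (X : ℝ≥0 → Ω → ℝ) (P : Measure Ω) :
    Prop where
  measurable : ∀ t, Measurable (X t)
  start_zero : ∀ᵐ ω ∂P, X 0 ω = 0
  indep_increments : HasIndepIncrements X P
  stationary_increments : ∀ s t : ℝ≥0,
    P.map (fun ω => X (s + t) ω - X s ω) = P.map (X t)
  stochastically_continuous : ∀ t : ℝ≥0, TendstoInMeasure P X (𝓝 t) (X t)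
  /-- Almost every path is right-continuous with left limits. -/
  cadlag : ∀ᵐ ω ∂P, ∀ t : ℝ≥0, ContinuousWithinAt (fun s => X s ω) (Ici t) t ∧
    ∃ l : ℝ, Tendsto (fun s => X s ω) (𝓝[<] t) (𝓝 l)

/-- The process is symmetric: `-X_t` has the same law as `X_t`. -/
def IsSymmetricProcess {Ω : Type*} [MeasurableSpace Ω] (X : ℝ≥0 → Ω → ℝ) (P : Measure Ω) :
    Prop :=
  ∀ t, P.map (fun ω => -X t ω) = P.map (X t)

/-- `Ψ` is the (real-valued) Lévy-Khintchine exponent of `X`: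
`E exp(i ξ X_t) = exp(-t Ψ(ξ))` for `t > 0` and real `ξ`. -/
def IsLevyKhintchineExponent {Ω : Type*} [MeasurableSpace Ω] (X : ℝ≥0 → Ω → ℝ) (P : Measure Ω)
    (Ψ : ℝ → ℝ) : Prop :=
  ∀ t : ℝ≥0, 0 < t → ∀ ξ : ℝ,
    ∫ ω, Complex.exp (Complex.I * (ξ : ℂ) * (X t ω : ℂ)) ∂P
      = Complex.exp (-((t : ℝ) : ℂ) * (Ψ ξ : ℂ))

/-- `f` is a complete Bernstein function on `(0, ∞)`:
`f(x) = c₁ + c₂ x + (1/π) ∫_{(0,∞)} x / (x + s) m(ds) / s` with `c₁, c₂ ≥ 0` and a measure `m` on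
`(0, ∞)` with `∫ min(s⁻¹, s⁻²) m(ds) < ∞` (which makes `m` a Radon measure on `(0, ∞)`). -/
def IsCompleteBernstein (f : ℝ → ℝ) : Prop :=
  ∃ (c₁ c₂ : ℝ) (m : Measure ℝ), 0 ≤ c₁ ∧ 0 ≤ c₂ ∧ m (Iic 0) = 0 ∧
    (∫⁻ s, ENNReal.ofReal (min s⁻¹ (s ^ 2)⁻¹) ∂m) < ⊤ ∧
    ∀ x : ℝ, 0 < x → f x = c₁ + c₂ * x + (1 / Real.pi) * ∫ s, x / (x + s) / s ∂m

/-- `f` is completely monotone on `[0, ∞)`: continuous on `[0, ∞)`, smooth on `(0, ∞)`, with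
`(-1)ⁿ f⁽ⁿ⁾ ≥ 0` on `(0, ∞)` for every `n ≥ 0`. -/
def IsCompletelyMonotoneOnIci (f : ℝ → ℝ) : Prop :=
  ContinuousOn f (Ici 0) ∧ ContDiffOn ℝ ((⊤ : ℕ∞) : WithTop ℕ∞) f (Ioi 0) ∧
    ∀ (n : ℕ) (x : ℝ), 0 < x → 0 ≤ (-1 : ℝ) ^ n * iteratedDeriv n f x

/-- The function `ξ ↦ 2λ / (λ² - ξ²) - Ψ'(λ) / (Ψ(λ) - Ψ(ξ))`. -/
def thetaKernel (Ψ : ℝ → ℝ) (lam ξ : ℝ) : ℝ :=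
  2 * lam / (lam ^ 2 - ξ ^ 2) - deriv Ψ lam / (Ψ lam - Ψ ξ)

/-- The phase shift `ϑ_λ`. -/
def theta (Ψ : ℝ → ℝ) (lam : ℝ) : ℝ :=
  Real.arctan ((1 / Real.pi) * ∫ ξ in Ioi 0, thetaKernel Ψ lam ξ)

/-- The prescribed Fourier transform of `G_λ`. -/
def fourierG (Ψ : ℝ → ℝ) (lam ξ : ℝ) : ℝ :=
  Real.cos (theta Ψ lam) * thetaKernel Ψ lam ξ

/-- `G_λ`, given by the inverse Fourier integral `(2π)⁻¹ ∫ exp(-iξx) (ℱ G_λ)(ξ) dξ`. -/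
def eigenG (Ψ : ℝ → ℝ) (lam x : ℝ) : ℝ :=
  ((1 / (2 * Real.pi) : ℂ) *
    ∫ ξ : ℝ, Complex.exp (-Complex.I * (ξ : ℂ) * (x : ℂ)) * (fourierG Ψ lam ξ : ℂ)).re

/-- `G` is an `L²(ℝ) ∩ C₀(ℝ)` function whose Fourier transform, in the convention
`ℱ φ(ξ) = ∫ exp(iξx) φ(x) dx` and in the sense of tempered distributions
(`⟨ℱ G, φ⟩ = ⟨G, ℱ φ⟩` for Schwartz `φ`), is the integrable function `g`. -/
structure IsL2C0WithFourier (G g : ℝ → ℝ) : Prop where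
  continuous : Continuous G
  vanishing : Tendsto G (cocompact ℝ) (𝓝 0)
  memLp : MemLp G 2 volume
  integrable : Integrable g
  fourier : ∀ φ : 𝓢(ℝ, ℂ),
    ∫ x : ℝ, (G x : ℂ) * ∫ ξ : ℝ, Complex.exp (Complex.I * (ξ : ℂ) * (x : ℂ)) * φ ξ
      = ∫ ξ : ℝ, (g ξ : ℂ) * φ ξ

end

/-! Everything is read off the even kernel k(ξ) = 2λ/(λ² - ξ²) - Ψ'(λ)/(Ψ(λ) - Ψ(ξ)), whose poles at
±λ cancel. Far out it is dominated by 1/(1 + ξ²) and 1/(1 + Ψ), so a bound near λ makes it bounded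
and integrable, hence in L¹ ∩ L². Riemann-Lebesgue and Plancherel then put G in C₀ ∩ L², and G(0) =
cos ϑ · (1/π)∫₀^∞ k = cos ϑ tan ϑ = sin ϑ.

In part (a) differentiability of Ψ' bounds k near λ, and concavity of x ↦ Ψ(√x) gives k ≥ 0
(`thetaKernel_nonneg`). A function with nonnegative Fourier transform is largest in modulus at 0.

In part (b) put a = λ² and b = ξ². The complete Bernstein representation gives ψ(b) - ψ(a) = (b - a)
S(b) with S(b) = c + ∫ (1 + s)/(s + b) ν(ds), so Ψ'(λ) = 2λ S(a) and k(ξ) = 2λ N(b)/S(b), where N(b)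
= (S(a) - S(b))/(b - a). The crux is that N/S is again a Stieltjes function. For finite sums this is
the spectral theorem for a diagonal matrix plus a rank one matrix (`exists_sum_resolvent`). The
general case follows by discretizing ν and using weak compactness of measures on [0, 1]
(`IsStieltjesFunction.of_tendsto`).

Integrability and boundedness of k remove the degenerate atoms of the Stieltjes measure, and k
becomes a mixture ∫ 2α/(α² + ξ²) γ(dα) of Cauchy kernels (`IsStieltjesFunction.exists_measure`).
Each of these is the Fourier transform of exp(-α|x|), so by Fourier inversion G is cos ϑ times the
Laplace transform of γ at |x|. Complete monotonicity and the value of ∫ G follow. For the explicit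
formula, the identity theorem carries the mixture representation to Re z > 0
(`extension_kernel_eq`), and Stieltjes inversion on the imaginary axis identifies the density of γ.
-/

noncomputable section

/-! ### Regularity of the exponent; boundedness, integrability and sign of the kernel -/

/-- The structural facts about a Lévy-Khintchine exponent that do not depend on the process. -/
structure IsRegularExponent (Ψ : ℝ → ℝ) : Prop where
  continuous : Continuous Ψ
  even : ∀ ξ, Ψ (-ξ) = Ψ ξ
  zero : Ψ 0 = 0
  nonneg : ∀ ξ, 0 ≤ Ψ ξ
  deriv_pos : ∀ ξ, 0 < ξ → 0 < deriv Ψ ξ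
  integrable : Integrable (fun ξ : ℝ => 1 / (1 + Ψ ξ))

/-- exp(-Ψ) is the characteristic function of the law of X₁, so Ψ = -log Re of it. Continuity,
evenness (conjugation fixes the real part), Ψ(0) = 0 and Ψ ≥ 0 (modulus at most one) are inherited
from there. -/
theorem IsLevyKhintchineExponent.isRegularExponent {Ω : Type*} [MeasurableSpace Ω]
    {P : Measure Ω} [IsProbabilityMeasure P] {X : ℝ≥0 → Ω → ℝ} {Ψ : ℝ → ℝ}
    (hX : Measurable (X 1)) (hΨ : IsLevyKhintchineExponent X P Ψ)
    (hpos : ∀ ξ : ℝ, 0 < ξ → 0 < deriv Ψ ξ)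
    (hint : Integrable (fun ξ : ℝ => 1 / (1 + Ψ ξ))) : IsRegularExponent Ψ := by
  have : IsProbabilityMeasure (P.map (X 1)) := Measure.isProbabilityMeasure_map hX.aemeasurable
  have key : ∀ ξ : ℝ, charFun (P.map (X 1)) ξ = ((Real.exp (-Ψ ξ) : ℝ) : ℂ) := by
    intro ξ
    rw [charFun_apply_real, integral_map hX.aemeasurable (by fun_prop)]
    have h := hΨ 1 one_pos ξ
    simp only [NNReal.coe_one, Complex.ofReal_one, neg_mul, one_mul] at h
    rw [Complex.ofReal_exp, Complex.ofReal_neg, ← h]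
    refine integral_congr_ae (ae_of_all _ fun ω => ?_)
    simp only
    congr 1
    ring
  have hlog : ∀ ξ, Ψ ξ = -Real.log (charFun (P.map (X 1)) ξ).re := by
    intro ξ
    rw [key, Complex.ofReal_re, Real.log_exp, neg_neg]
  refine ⟨?_, ?_, ?_, ?_, hpos, hint⟩
  · have : Continuous fun ξ => -Real.log (charFun (P.map (X 1)) ξ).re := by
      refine (Continuous.log (Complex.continuous_re.comp continuous_charFun) fun ξ => ?_).neg
      rw [Function.comp_apply, key, Complex.ofReal_re]
      exact (Real.exp_pos _).ne'
    rwa [← funext hlog] at this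
  · intro ξ
    rw [hlog, hlog, charFun_neg, Complex.conj_re]
  · rw [hlog, charFun_zero]
    simp
  · intro ξ
    have h := norm_charFun_le_one (μ := P.map (X 1)) ξ
    rw [key, Complex.norm_real, Real.norm_eq_abs, Real.abs_exp, Real.exp_le_one_iff] at h
    linarith

namespace IsRegularExponent

variable {Ψ : ℝ → ℝ} {lam : ℝ}

theorem differentiableAt (h : IsRegularExponent Ψ) {ξ : ℝ} (hξ : 0 < ξ) :
    DifferentiableAt ℝ Ψ ξ :=
  differentiableAt_of_deriv_ne_zero (h.deriv_pos ξ hξ).ne'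

theorem strictMonoOn (h : IsRegularExponent Ψ) : StrictMonoOn Ψ (Ici 0) := by
  refine strictMonoOn_of_deriv_pos (convex_Ici 0) h.continuous.continuousOn fun x hx => ?_
  rw [interior_Ici] at hx
  exact h.deriv_pos x hx

theorem apply_abs (h : IsRegularExponent Ψ) (ξ : ℝ) : Ψ |ξ| = Ψ ξ := by
  rcases abs_cases ξ with ⟨h1, -⟩ | ⟨h1, -⟩ <;> rw [h1]
  exact h.even ξ

theorem thetaKernel_neg (h : IsRegularExponent Ψ) (ξ : ℝ) :
    thetaKernel Ψ lam (-ξ) = thetaKernel Ψ lam ξ := by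
  simp [thetaKernel, h.even]

theorem thetaKernel_abs (h : IsRegularExponent Ψ) (ξ : ℝ) :
    thetaKernel Ψ lam |ξ| = thetaKernel Ψ lam ξ := by
  simp [thetaKernel, h.apply_abs]

/-- Both denominators vanish and division by zero gives 0, so this is not the limit value of the
kernel at λ. It concerns a null set only. -/
theorem thetaKernel_self : thetaKernel Ψ lam lam = 0 := by
  simp [thetaKernel]

theorem fourierG_neg (h : IsRegularExponent Ψ) (ξ : ℝ) :
    fourierG Ψ lam (-ξ) = fourierG Ψ lam ξ := by
  simp [fourierG, h.thetaKernel_neg]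

theorem fourierG_zero (h : IsRegularExponent Ψ) (hlam : 0 < lam) :
    fourierG Ψ lam 0 = 2 * Real.cos (theta Ψ lam) / lam *
          (1 - lam * deriv Ψ lam / (2 * Ψ lam)) := by
  have hp : 0 < Ψ lam := by
    have := h.strictMonoOn (mem_Ici.2 le_rfl) (mem_Ici.2 hlam.le) hlam
    rwa [h.zero] at this
  have hp' := hp.ne'
  simp only [fourierG, thetaKernel, h.zero, sub_zero, ne_eq, OfNat.ofNat_ne_zero,
    not_false_eq_true, zero_pow]
  field_simp

theorem apply_ne (h : IsRegularExponent Ψ) (hlam : 0 < lam) {ξ : ℝ} (hξ : 0 ≤ ξ) (hne : ξ ≠ lam) :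
    Ψ lam - Ψ ξ ≠ 0 := by
  intro h0
  exact hne (h.strictMonoOn.injOn (mem_Ici.2 hξ) (mem_Ici.2 hlam.le) (by linarith))

theorem measurable_thetaKernel (h : IsRegularExponent Ψ) : Measurable (thetaKernel Ψ lam) := by
  have := h.continuous.measurable
  unfold thetaKernel
  fun_prop

theorem continuousAt_thetaKernel (h : IsRegularExponent Ψ) (hlam : 0 < lam) {ξ : ℝ} (hξ : 0 ≤ ξ)
    (hne : ξ ≠ lam) : ContinuousAt (thetaKernel Ψ lam) ξ := by
  have h1 : lam ^ 2 - ξ ^ 2 ≠ 0 := by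
    intro h0
    exact hne ((sq_eq_sq₀ hξ hlam.le).1 (by linarith))
  have h2 := h.apply_ne hlam hξ hne
  have := h.continuous
  unfold thetaKernel
  fun_prop (disch := assumption)

/-- Away from `±λ` the kernel is dominated by integrable functions, so a bound near `λ` yields a
global bound and integrability. -/
theorem exists_bound_thetaKernel (h : IsRegularExponent Ψ) (hlam : 0 < lam)
    (hloc : ∃ C, ∀ᶠ ξ in 𝓝 lam, |thetaKernel Ψ lam ξ| ≤ C) :
    (∃ C, ∀ ξ, |thetaKernel Ψ lam ξ| ≤ C) ∧ Integrable (thetaKernel Ψ lam) := by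
  obtain ⟨C₀, hC₀⟩ := hloc
  have hbdd : ∃ C, ∀ ξ ∈ Icc 0 (lam + 1), |thetaKernel Ψ lam ξ| ≤ C := by
    have : ∀ ξ ∈ Icc 0 (lam + 1), ∃ C, ∀ᶠ η in 𝓝 ξ, |thetaKernel Ψ lam η| ≤ C := by
      intro ξ hξ
      by_cases hne : ξ = lam
      · exact ⟨C₀, hne ▸ hC₀⟩
      · refine ⟨|thetaKernel Ψ lam ξ| + 1, ?_⟩
        have := (h.continuousAt_thetaKernel hlam hξ.1 hne).abs
        filter_upwards [this.eventually (gt_mem_nhds (lt_add_one _))] with η hη using hη.le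
    choose! C hC using this
    obtain ⟨t, ht, hcov⟩ := isCompact_Icc.elim_nhds_subcover
      (fun ξ => {η | |thetaKernel Ψ lam η| ≤ C ξ}) (fun ξ hξ => hC ξ hξ)
    refine ⟨∑ ξ ∈ t, |C ξ|, fun η hη => ?_⟩
    obtain ⟨ξ, hξ, hη'⟩ := mem_iUnion₂.1 (hcov hη)
    exact (le_trans hη' (le_abs_self _)).trans
      (Finset.single_le_sum (f := fun ξ => |C ξ|) (fun _ _ => abs_nonneg _) hξ)
  obtain ⟨C₁, hC₁⟩ := hbdd
  have hC₁0 : 0 ≤ C₁ := (abs_nonneg _).trans (hC₁ 0 ⟨le_rfl, by linarith⟩)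
  have hD := h.deriv_pos lam hlam
  -- `A` and `B` make the two tail estimates below equalities at ξ = λ + 1. They persist beyond it
  -- because (1 + t)/(t - t₀) decreases in t > t₀ when t₀ ≥ 0.
  set q := Ψ (lam + 1) - Ψ lam with hq
  have hqpos : 0 < q := sub_pos.2
    (h.strictMonoOn (mem_Ici.2 hlam.le) (mem_Ici.2 (by linarith)) (lt_add_one _))
  set A := deriv Ψ lam * (1 + Ψ (lam + 1)) / q with hA
  have hApos : 0 ≤ A := by
    have := h.nonneg (lam + 1)
    positivity
  set B := 2 * lam * (1 + (lam + 1) ^ 2) / (2 * lam + 1) with hB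
  have hBpos : 0 ≤ B := by positivity
  have htail : ∀ ξ, lam + 1 ≤ ξ →
      |thetaKernel Ψ lam ξ| ≤ B * (1 + ξ ^ 2)⁻¹ + A * (1 / (1 + Ψ ξ)) := by
    intro ξ hξ
    have hmono : Ψ (lam + 1) ≤ Ψ ξ := h.strictMonoOn.monotoneOn
      (mem_Ici.2 (by linarith)) (mem_Ici.2 (by linarith)) hξ
    have h1 : |2 * lam / (lam ^ 2 - ξ ^ 2)| ≤ B * (1 + ξ ^ 2)⁻¹ := by
      have hneg : 0 < ξ ^ 2 - lam ^ 2 := by nlinarith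
      rw [abs_div, abs_of_pos (by positivity : 0 < 2 * lam), abs_of_neg (by linarith), neg_sub,
        ← div_eq_mul_inv, hB, div_div, div_le_div_iff₀ hneg (by positivity)]
      have : (lam + 1) ^ 2 ≤ ξ ^ 2 := by nlinarith
      have h3 : (1 + ξ ^ 2) * (2 * lam + 1) ≤ (1 + (lam + 1) ^ 2) * (ξ ^ 2 - lam ^ 2) := by
        nlinarith
      nlinarith
    have h2 : |deriv Ψ lam / (Ψ lam - Ψ ξ)| ≤ A * (1 / (1 + Ψ ξ)) := by
      have hneg : 0 < Ψ ξ - Ψ lam := by linarith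
      have := h.nonneg ξ
      have := h.nonneg lam
      rw [abs_div, abs_of_pos hD, abs_of_neg (by linarith), neg_sub, mul_one_div, hA, div_div,
        div_le_div_iff₀ hneg (by positivity)]
      have h3 : (1 + Ψ ξ) * q ≤ (1 + Ψ (lam + 1)) * (Ψ ξ - Ψ lam) := by
        rw [hq]; nlinarith
      nlinarith
    exact (abs_sub _ _).trans (add_le_add h1 h2)
  have hall : ∀ ξ, |thetaKernel Ψ lam ξ| ≤
      (C₁ * (1 + (lam + 1) ^ 2) + B) * (1 + ξ ^ 2)⁻¹ + A * (1 / (1 + Ψ ξ)) := by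
    intro ξ
    rw [← h.thetaKernel_abs, ← h.apply_abs, ← sq_abs ξ]
    have h0 := abs_nonneg ξ
    generalize |ξ| = η at h0
    have := h.nonneg η
    rcases le_total η (lam + 1) with h1 | h1
    · have h2 := hC₁ η ⟨h0, h1⟩
      have h3 : C₁ ≤ C₁ * (1 + (lam + 1) ^ 2) * (1 + η ^ 2)⁻¹ := by
        rw [← div_eq_mul_inv, le_div_iff₀ (by positivity)]
        gcongr
      have : 0 ≤ B * (1 + η ^ 2)⁻¹ := by positivity
      have : 0 ≤ A * (1 / (1 + Ψ η)) := by positivity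
      linarith
    · have h2 := htail η h1
      have : 0 ≤ C₁ * (1 + (lam + 1) ^ 2) * (1 + η ^ 2)⁻¹ := by positivity
      linarith
  refine ⟨⟨(C₁ * (1 + (lam + 1) ^ 2) + B) + A, fun ξ => (hall ξ).trans ?_⟩, ?_⟩
  · have := h.nonneg ξ
    have h1 : (1 + ξ ^ 2)⁻¹ ≤ 1 := inv_le_one_of_one_le₀ (by nlinarith)
    have h2 : 1 / (1 + Ψ ξ) ≤ 1 := by
      rw [div_le_one (by positivity)]; linarith
    exact add_le_add (mul_le_of_le_one_right (by positivity) h1)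
      (mul_le_of_le_one_right hApos h2)
  · exact ((integrable_inv_one_add_sq.const_mul _).add (h.integrable.const_mul A)).mono'
      h.measurable_thetaKernel.aestronglyMeasurable (ae_of_all _ hall)

/-- The kernel is bounded near `λ` as soon as `Ψ'` is differentiable at `λ`. -/
theorem eventually_bound_thetaKernel (h : IsRegularExponent Ψ) (hlam : 0 < lam)
    (hd : DifferentiableAt ℝ (deriv Ψ) lam) :
    ∃ C, ∀ᶠ ξ in 𝓝 lam, |thetaKernel Ψ lam ξ| ≤ C := by
  have hD := h.deriv_pos lam hlam
  obtain ⟨M, hM⟩ := hd.isBigO_sub.bound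
  have hcont := hd.continuousAt.eventually (lt_mem_nhds (half_lt_self hD))
  have hpos : ∀ᶠ ξ in 𝓝 lam, 0 < ξ := lt_mem_nhds hlam
  obtain ⟨ε, hε, hball⟩ := Metric.eventually_nhds_iff_ball.1 (hM.and (hcont.and hpos))
  refine ⟨1 / lam + |M| * 2 / deriv Ψ lam, ?_⟩
  filter_upwards [Metric.ball_mem_nhds lam hε] with ξ hξ
  by_cases hne : ξ = lam
  · rw [hne, thetaKernel_self, abs_zero]; positivity
  have hξ0 : 0 < ξ := (hball ξ hξ).2.2
  have hseg : ∀ c ∈ uIcc lam ξ, c ∈ Metric.ball lam ε := fun c hc =>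
    (convex_ball lam ε).ordConnected.uIcc_subset (Metric.mem_ball_self hε) hξ hc
  obtain ⟨c, hc, hcs⟩ : ∃ c ∈ uIcc lam ξ, Ψ lam - Ψ ξ = deriv Ψ c * (lam - ξ) := by
    rcases lt_or_gt_of_ne hne with hlt | hlt
    · obtain ⟨c, hc, hs⟩ := exists_deriv_eq_slope Ψ hlt h.continuous.continuousOn
        (fun x hx => (h.differentiableAt (hξ0.trans hx.1)).differentiableWithinAt)
      refine ⟨c, ?_, ?_⟩
      · rw [uIcc_of_ge hlt.le]; exact Ioo_subset_Icc_self hc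
      · rw [hs, div_mul_cancel₀ _ (by linarith)]
    · obtain ⟨c, hc, hs⟩ := exists_deriv_eq_slope Ψ hlt h.continuous.continuousOn
        (fun x hx => (h.differentiableAt (hlam.trans hx.1)).differentiableWithinAt)
      refine ⟨c, ?_, ?_⟩
      · rw [uIcc_of_le hlt.le]; exact Ioo_subset_Icc_self hc
      · rw [hs, ← neg_sub ξ lam, mul_neg, div_mul_cancel₀ _ (by linarith), neg_sub]
  obtain ⟨h1, h2, -⟩ := hball c (hseg c hc)
  have hc0 : 0 < deriv Ψ c := by linarith
  have hcl : |c - lam| ≤ |lam - ξ| := by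
    rw [abs_sub_comm lam ξ]
    exact abs_sub_left_of_mem_uIcc hc
  have hne' : lam - ξ ≠ 0 := sub_ne_zero.2 (Ne.symm hne)
  have hsum : lam + ξ ≠ 0 := by positivity
  -- Partial fractions of 2λ/(λ² - ξ²) isolate 1/(λ - ξ), which cancels against the second quotient
  -- up to Ψ'(c) - Ψ'(λ) = O(λ - ξ). The factor 2 in the bound comes from Ψ'(c) > Ψ'(λ)/2 on the
  -- ball.
  have hK : thetaKernel Ψ lam ξ
      = 1 / (lam + ξ) + (deriv Ψ c - deriv Ψ lam) / (deriv Ψ c * (lam - ξ)) := by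
    rw [thetaKernel, hcs, show lam ^ 2 - ξ ^ 2 = (lam - ξ) * (lam + ξ) by ring]
    field_simp
    ring
  rw [hK]
  refine (abs_add_le _ _).trans (add_le_add ?_ ?_)
  · rw [abs_of_pos (by positivity)]
    exact one_div_le_one_div_of_le hlam (by linarith)
  · rw [abs_div, abs_mul, abs_of_pos hc0, div_le_div_iff₀ (by positivity) hD]
    rw [Real.norm_eq_abs, Real.norm_eq_abs] at h1
    have h3 : |deriv Ψ c - deriv Ψ lam| ≤ |M| * |lam - ξ| :=
      h1.trans (mul_le_mul (le_abs_self _) hcl (abs_nonneg _) (abs_nonneg _))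
    calc |deriv Ψ c - deriv Ψ lam| * deriv Ψ lam
        ≤ (|M| * |lam - ξ|) * (2 * deriv Ψ c) := by gcongr; linarith
      _ = |M| * 2 * (deriv Ψ c * |lam - ξ|) := by ring

/-- The kernel is nonnegative if `x ↦ Ψ(√x)` is concave. -/
theorem thetaKernel_nonneg (h : IsRegularExponent Ψ) (hlam : 0 < lam)
    (hanti : AntitoneOn (fun ξ => deriv Ψ ξ / ξ) (Ioi 0)) (ξ : ℝ) :
    0 ≤ thetaKernel Ψ lam ξ := by
  rw [← h.thetaKernel_abs]
  have h0 := abs_nonneg ξ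
  generalize |ξ| = η at h0
  by_cases hne : η = lam
  · rw [hne, thetaKernel_self]
  have hD := h.deriv_pos lam hlam
  have hsq : ∀ x : ℝ, deriv (fun x => x ^ 2) x = 2 * x := fun x => by simp
  rcases lt_or_gt_of_ne hne with hlt | hlt
  -- Cauchy's mean value theorem against x² gives (Ψ(λ) - Ψ(η))/(λ² - η²) = Ψ'(c)/(2c), which is at
  -- least Ψ'(λ)/(2λ) since c < λ. In the other case c > λ, and both this inequality and the signs
  -- of the denominators are reversed.
  · obtain ⟨c, hc, hs⟩ := exists_ratio_deriv_eq_ratio_slope Ψ hlt h.continuous.continuousOn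
      (fun x hx => (h.differentiableAt (h0.trans_lt hx.1)).differentiableWithinAt)
      (fun x => x ^ 2) (by fun_prop) (by fun_prop)
    rw [hsq] at hs
    have hc0 : 0 < c := h0.trans_lt hc.1
    have hle := hanti (mem_Ioi.2 hc0) (mem_Ioi.2 hlam) hc.2.le
    simp only at hle
    rw [div_le_div_iff₀ hlam hc0] at hle
    have h1 : 0 < Ψ lam - Ψ η :=
      sub_pos.2 (h.strictMonoOn (mem_Ici.2 h0) (mem_Ici.2 hlam.le) hlt)
    have h2 : 0 < lam ^ 2 - η ^ 2 := by nlinarith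
    rw [thetaKernel, sub_nonneg, div_le_div_iff₀ h1 h2]
    have h3 : c * (deriv Ψ lam * (lam ^ 2 - η ^ 2)) ≤ c * (2 * lam * (Ψ lam - Ψ η)) := by
      calc c * (deriv Ψ lam * (lam ^ 2 - η ^ 2)) = (deriv Ψ lam * c) * (lam ^ 2 - η ^ 2) := by ring
        _ ≤ (deriv Ψ c * lam) * (lam ^ 2 - η ^ 2) := by gcongr
        _ = lam * ((lam ^ 2 - η ^ 2) * deriv Ψ c) := by ring
        _ = c * (2 * lam * (Ψ lam - Ψ η)) := by rw [hs]; ring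
    exact le_of_mul_le_mul_left h3 hc0
  · obtain ⟨c, hc, hs⟩ := exists_ratio_deriv_eq_ratio_slope Ψ hlt h.continuous.continuousOn
      (fun x hx => (h.differentiableAt (hlam.trans hx.1)).differentiableWithinAt)
      (fun x => x ^ 2) (by fun_prop) (by fun_prop)
    rw [hsq] at hs
    have hc0 : 0 < c := hlam.trans hc.1
    have hle := hanti (mem_Ioi.2 hlam) (mem_Ioi.2 hc0) hc.1.le
    simp only at hle
    rw [div_le_div_iff₀ hc0 hlam] at hle
    have h1 : 0 < Ψ η - Ψ lam :=
      sub_pos.2 (h.strictMonoOn (mem_Ici.2 hlam.le) (mem_Ici.2 h0) hlt)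
    have h2 : 0 < η ^ 2 - lam ^ 2 := by nlinarith
    rw [thetaKernel, ← neg_sub (η ^ 2), ← neg_sub (Ψ η), div_neg, div_neg, sub_neg_eq_add,
      neg_add_eq_sub, sub_nonneg, div_le_div_iff₀ h2 h1]
    have h3 : c * (2 * lam * (Ψ η - Ψ lam)) ≤ c * (deriv Ψ lam * (η ^ 2 - lam ^ 2)) := by
      calc c * (2 * lam * (Ψ η - Ψ lam)) = lam * ((η ^ 2 - lam ^ 2) * deriv Ψ c) := by
            rw [hs]; ring
        _ = (deriv Ψ c * lam) * (η ^ 2 - lam ^ 2) := by ring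
        _ ≤ (deriv Ψ lam * c) * (η ^ 2 - lam ^ 2) := by gcongr
        _ = c * (deriv Ψ lam * (η ^ 2 - lam ^ 2)) := by ring
    exact le_of_mul_le_mul_left h3 hc0

/-- The derivative of Ψ'(ξ)/ξ has numerator ξΨ'' - Ψ' ≤ -Ψ'/2 < 0. -/
theorem antitoneOn_deriv_div (h : IsRegularExponent Ψ)
    (hd : ∀ ξ : ℝ, 0 < ξ → DifferentiableAt ℝ (deriv Ψ) ξ)
    (hle : ∀ ξ : ℝ, 0 < ξ → 2 * ξ * deriv (deriv Ψ) ξ ≤ deriv Ψ ξ) :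
    AntitoneOn (fun ξ => deriv Ψ ξ / ξ) (Ioi 0) := by
  have hder : ∀ ξ : ℝ, 0 < ξ → HasDerivAt (fun ξ => deriv Ψ ξ / ξ)
      ((deriv (deriv Ψ) ξ * ξ - deriv Ψ ξ * 1) / ξ ^ 2) ξ := fun ξ hξ =>
    (hd ξ hξ).hasDerivAt.div (hasDerivAt_id ξ) hξ.ne'
  refine antitoneOn_of_deriv_nonpos (convex_Ioi 0)
    (fun ξ hξ => (hder ξ hξ).continuousAt.continuousWithinAt) ?_ ?_
  · rw [interior_Ioi]
    exact fun ξ hξ => (hder ξ hξ).differentiableAt.differentiableWithinAt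
  · rw [interior_Ioi]
    intro ξ hξ
    rw [(hder ξ hξ).deriv]
    refine div_nonpos_of_nonpos_of_nonneg ?_ (sq_nonneg _)
    have := hle ξ hξ
    have := h.deriv_pos ξ hξ
    linarith

end IsRegularExponent

/-! ### Fourier inversion in L² ∩ C₀ -/

section FourierTransform

open scoped FourierTransform

/-- The Fourier transform of an integrable function in `L²` is in `L²`. -/
theorem memLp_two_fourier {f : ℝ → ℂ} (hf : Integrable f) (hf2 : MemLp f 2 volume) :
    MemLp (𝓕 f) 2 volume := by
  set F : Lp ℂ 2 (volume : Measure ℝ) := 𝓕 (hf2.toLp f) with hF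
  have hcont : Continuous (𝓕 f) :=
    VectorFourier.fourierIntegral_continuous Real.continuous_fourierChar
      (by fun_prop : Continuous fun p : ℝ × ℝ => innerₗ ℝ p.1 p.2) hf
  have hFmem : MemLp F 2 volume := Lp.memLp F
  -- The Plancherel extension `F` and the pointwise integral agree as distributions: both move onto
  -- the test function by the multiplication formula.
  have hae : ∀ᵐ x, F x = 𝓕 f x := by
    refine ae_eq_of_integral_contDiff_smul_eq (hFmem.locallyIntegrable (by norm_num))
      hcont.locallyIntegrable fun φ hφ hcs => ?_
    have hφ' : ContDiff ℝ ((⊤ : ℕ∞) : WithTop ℕ∞) (fun x => (φ x : ℂ)) :=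
      Complex.ofRealCLM.contDiff.comp hφ
    have hcs' : HasCompactSupport (fun x => (φ x : ℂ)) :=
      hcs.comp_left (g := fun x : ℝ => (x : ℂ)) Complex.ofReal_zero
    set s : 𝓢(ℝ, ℂ) := hcs'.toSchwartzMap hφ' with hs
    have hsφ : ∀ x, s x = (φ x : ℂ) := fun x => rfl
    have h1 : Lp.toTemperedDistribution F s
        = Lp.toTemperedDistribution (hf2.toLp f) (𝓕 s) := by
      rw [hF, ← Lp.fourier_toTemperedDistribution_eq, TemperedDistribution.fourier_apply]
    rw [Lp.toTemperedDistribution_apply, Lp.toTemperedDistribution_apply] at h1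
    have h2 : ∫ x, 𝓕 f x • s x = ∫ x, f x • 𝓕 (s : ℝ → ℂ) x := by
      have := VectorFourier.integral_fourierIntegral_smul_eq_flip (L := innerₗ ℝ)
        Real.continuous_fourierChar (by fun_prop) hf (s.integrable (μ := volume))
      rwa [flip_innerₗ] at this
    calc ∫ x, φ x • F x = ∫ x, s x • F x := by
          simp only [hsφ, Complex.real_smul, smul_eq_mul]
      _ = ∫ x, 𝓕 s x • (hf2.toLp f) x := h1
      _ = ∫ x, f x • 𝓕 (s : ℝ → ℂ) x := by
          refine integral_congr_ae ?_
          filter_upwards [hf2.coeFn_toLp] with x hx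
          rw [hx, SchwartzMap.fourier_coe, smul_eq_mul, smul_eq_mul, mul_comm]
      _ = ∫ x, φ x • 𝓕 f x := by
          rw [← h2]
          simp only [hsφ, Complex.real_smul, smul_eq_mul, mul_comm]
  exact hFmem.ae_eq hae

/-- The real part of the inverse Fourier integral `(2π)⁻¹ ∫ exp(-iξx) g(ξ) dξ`. -/
def invFourierRe (g : ℝ → ℝ) (x : ℝ) : ℝ :=
  ((1 / (2 * Real.pi) : ℂ) *
    ∫ ξ : ℝ, Complex.exp (-Complex.I * (ξ : ℂ) * (x : ℂ)) * (g ξ : ℂ)).re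

theorem eigenG_eq_invFourierRe (Ψ : ℝ → ℝ) (lam : ℝ) :
    eigenG Ψ lam = invFourierRe (fourierG Ψ lam) := rfl

section

variable {g : ℝ → ℝ}

theorem integral_exp_mul_eq_fourier (x : ℝ) :
    ∫ ξ : ℝ, Complex.exp (-Complex.I * (ξ : ℂ) * (x : ℂ)) * (g ξ : ℂ)
      = 𝓕 (fun ξ => (g ξ : ℂ)) (x / (2 * Real.pi)) := by
  rw [Real.fourier_real_eq_integral_exp_smul]
  refine integral_congr_ae (ae_of_all _ fun ξ => ?_)
  simp only [smul_eq_mul]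
  congr 2
  have : (Real.pi : ℂ) ≠ 0 := by exact_mod_cast Real.pi_ne_zero
  push_cast
  field_simp

/-- The substitution ξ ↦ -ξ shows that the integral is its own conjugate, so taking the real part
loses nothing. -/
theorem ofReal_invFourierRe (heven : ∀ ξ, g (-ξ) = g ξ) (x : ℝ) :
    (invFourierRe g x : ℂ) = (1 / (2 * Real.pi) : ℂ) *
      ∫ ξ : ℝ, Complex.exp (-Complex.I * (ξ : ℂ) * (x : ℂ)) * (g ξ : ℂ) := by
  refine Complex.conj_eq_iff_re.1 ?_
  rw [map_mul, ← integral_conj]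
  congr 1
  · rw [map_div₀, map_mul, Complex.conj_ofReal, map_one, map_ofNat]
  · rw [← integral_neg_eq_self]
    refine integral_congr_ae (ae_of_all _ fun ξ => ?_)
    simp only [map_mul, ← Complex.exp_conj, map_neg, Complex.conj_I, Complex.conj_ofReal, heven]
    congr 2
    push_cast
    ring

theorem ofReal_invFourierRe_eq_fourier (heven : ∀ ξ, g (-ξ) = g ξ) (x : ℝ) :
    (invFourierRe g x : ℂ) =
      (1 / (2 * Real.pi) : ℂ) * 𝓕 (fun ξ => (g ξ : ℂ)) (x / (2 * Real.pi)) := by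
  rw [ofReal_invFourierRe heven, integral_exp_mul_eq_fourier]

/-- After rescaling by 2π this is Riemann-Lebesgue for the decay, Plancherel for L², and the
multiplication formula applied to the inverse transform of the test function. -/
theorem isL2C0WithFourier_invFourierRe (heven : ∀ ξ, g (-ξ) = g ξ) (hg : Integrable g)
    (hg2 : MemLp g 2 volume) : IsL2C0WithFourier (invFourierRe g) g := by
  have hgc : Integrable (fun ξ => (g ξ : ℂ)) := hg.ofReal
  have hcont : Continuous (𝓕 (fun ξ => (g ξ : ℂ))) :=
    VectorFourier.fourierIntegral_continuous Real.continuous_fourierChar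
      (by fun_prop : Continuous fun p : ℝ × ℝ => innerₗ ℝ p.1 p.2) hgc
  have hre : invFourierRe g = fun x =>
      ((1 / (2 * Real.pi) : ℂ) * 𝓕 (fun ξ => (g ξ : ℂ)) (x / (2 * Real.pi))).re := by
    funext x
    rw [← ofReal_invFourierRe_eq_fourier heven, Complex.ofReal_re]
  have hpi : (2 * Real.pi) ≠ 0 := by positivity
  have hcontG : Continuous (invFourierRe g) := by
    rw [hre]; fun_prop
  refine ⟨hcontG, ?_, ?_, hg, ?_⟩
  · have h1 : Tendsto (fun x : ℝ => x / (2 * Real.pi)) (cocompact ℝ) (cocompact ℝ) := by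
      have := (Homeomorph.mulRight₀ (2 * Real.pi)⁻¹ (inv_ne_zero hpi)).isClosedEmbedding.tendsto_cocompact
      simpa [div_eq_mul_inv] using this
    have h2 := (Real.zero_at_infty_fourier (fun ξ => (g ξ : ℂ))).comp h1
    have h3 := (Complex.continuous_re.tendsto _).comp (h2.const_mul (1 / (2 * Real.pi) : ℂ))
    rw [hre]
    rw [mul_zero, Complex.zero_re] at h3
    exact h3
  · have h1 := (memLp_two_fourier hgc hg2.ofReal).const_mul (1 / (2 * Real.pi) : ℂ)
    have h2 := (memLp_two_iff_integrable_sq_norm h1.1).1 h1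
    have h3 := h2.comp_div hpi
    refine (memLp_two_iff_integrable_sq_norm hcontG.aestronglyMeasurable).2 ?_
    refine h3.congr (ae_of_all _ fun x => ?_)
    simp only
    rw [← ofReal_invFourierRe_eq_fourier heven, Complex.norm_real]
  · intro φ
    have h1 : ∀ x : ℝ, ∫ ξ : ℝ, Complex.exp (Complex.I * (ξ : ℂ) * (x : ℂ)) * φ ξ
        = 𝓕⁻ (φ : ℝ → ℂ) (x / (2 * Real.pi)) := by
      intro x
      rw [Real.fourierInv_eq']
      refine integral_congr_ae (ae_of_all _ fun ξ => ?_)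
      simp only [smul_eq_mul]
      congr 2
      have : (Real.pi : ℂ) ≠ 0 := by exact_mod_cast Real.pi_ne_zero
      simp only [RCLike.inner_apply, conj_trivial]
      push_cast
      field_simp
    have h2 := VectorFourier.integral_fourierIntegral_smul_eq_flip (L := innerₗ ℝ)
        Real.continuous_fourierChar (by fun_prop) hgc ((𝓕⁻ φ).integrable (μ := volume))
    rw [flip_innerₗ] at h2
    have h3 : 𝓕 ((𝓕⁻ φ : 𝓢(ℝ, ℂ)) : ℝ → ℂ) = φ := by
      rw [← SchwartzMap.fourier_coe, FourierTransform.fourier_fourierInv_eq]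
    calc ∫ x : ℝ, (invFourierRe g x : ℂ) *
          ∫ ξ : ℝ, Complex.exp (Complex.I * (ξ : ℂ) * (x : ℂ)) * φ ξ
        = ∫ x : ℝ, (fun w : ℝ => (1 / (2 * Real.pi) : ℂ) * 𝓕 (fun ξ => (g ξ : ℂ)) w *
            𝓕⁻ (φ : ℝ → ℂ) w) (x / (2 * Real.pi)) := by
          refine integral_congr_ae (ae_of_all _ fun x => ?_)
          simp only [h1, ofReal_invFourierRe_eq_fourier heven]
      _ = ∫ w : ℝ, 𝓕 (fun ξ => (g ξ : ℂ)) w * 𝓕⁻ (φ : ℝ → ℂ) w := by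
          rw [Measure.integral_comp_div (fun w : ℝ => (1 / (2 * Real.pi) : ℂ) *
            𝓕 (fun ξ => (g ξ : ℂ)) w * 𝓕⁻ (φ : ℝ → ℂ) w), abs_of_pos (by positivity), ← integral_smul]
          refine integral_congr_ae (ae_of_all _ fun x => ?_)
          have : (Real.pi : ℂ) ≠ 0 := by exact_mod_cast Real.pi_ne_zero
          simp only [Complex.real_smul]
          push_cast
          field_simp
      _ = ∫ w : ℝ, 𝓕 (fun ξ => (g ξ : ℂ)) w • (𝓕⁻ φ) w := by
          simp only [SchwartzMap.fourierInv_coe, smul_eq_mul]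
      _ = ∫ ξ : ℝ, (g ξ : ℂ) • 𝓕 ((𝓕⁻ φ : 𝓢(ℝ, ℂ)) : ℝ → ℂ) ξ := h2
      _ = ∫ ξ : ℝ, (g ξ : ℂ) * φ ξ := by
          rw [h3]; rfl

theorem invFourierRe_zero : invFourierRe g 0 = (1 / (2 * Real.pi)) * ∫ ξ, g ξ := by
  have h : (1 / (2 * Real.pi) : ℂ) * ∫ ξ : ℝ, (g ξ : ℂ)
      = (((1 / (2 * Real.pi)) * ∫ ξ, g ξ : ℝ) : ℂ) := by
    rw [integral_complex_ofReal]; push_cast; rfl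
  simp only [invFourierRe, Complex.ofReal_zero, mul_zero, Complex.exp_zero, one_mul]
  rw [h, Complex.ofReal_re]

theorem abs_invFourierRe_le (hnonneg : ∀ ξ, 0 ≤ g ξ) (x : ℝ) :
    |invFourierRe g x| ≤ invFourierRe g 0 := by
  rw [invFourierRe_zero]
  refine (Complex.abs_re_le_norm _).trans ?_
  rw [norm_mul]
  have h1 : ‖(1 / (2 * Real.pi) : ℂ)‖ = 1 / (2 * Real.pi) := by
    rw [norm_div, norm_mul, Complex.norm_real, Real.norm_of_nonneg Real.pi_nonneg]
    simp
  rw [h1]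
  refine mul_le_mul_of_nonneg_left ?_ (by positivity)
  refine (norm_integral_le_integral_norm _).trans (le_of_eq ?_)
  refine integral_congr_ae (ae_of_all _ fun ξ => ?_)
  simp only [norm_mul, Complex.norm_real, Real.norm_of_nonneg (hnonneg ξ)]
  rw [Complex.norm_exp]
  simp

/-- Fourier inversion for a continuous integrable function with integrable even Fourier
transform. -/
theorem invFourierRe_eq_of_fourier {f : ℝ → ℝ} (hc : Continuous f) (hf : Integrable f)
    (hg : Integrable g) (heven : ∀ ξ, g (-ξ) = g ξ)
    (hfg : ∀ᵐ ξ : ℝ, ∫ x : ℝ, Complex.exp (Complex.I * (ξ : ℂ) * (x : ℂ)) * (f x : ℂ) = g ξ) :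
    invFourierRe g = f := by
  have hpi : (2 * Real.pi) ≠ 0 := by positivity
  have hpi' : (-(2 * Real.pi)) ≠ 0 := neg_ne_zero.2 hpi
  have h1 : ∀ᵐ w : ℝ, 𝓕 (fun x => (f x : ℂ)) w = (g (2 * Real.pi * w) : ℂ) := by
    -- The identity is known almost everywhere only, and dilation by -2π preserves null sets. The
    -- sign passes between the two conventions and is absorbed by evenness.
    have hqmp : Measure.QuasiMeasurePreserving (fun w : ℝ => -(2 * Real.pi) * w) := by
      refine ⟨by fun_prop, ?_⟩
      rw [Real.map_volume_mul_left hpi']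
      exact Measure.smul_absolutelyContinuous
    filter_upwards [hqmp.ae hfg] with w hw
    rw [neg_mul, heven] at hw
    rw [← hw, Real.fourier_real_eq_integral_exp_smul]
    refine integral_congr_ae (ae_of_all _ fun x => ?_)
    simp only [smul_eq_mul]
    congr 2
    push_cast
    ring
  have h2 : Integrable (fun w => (g (2 * Real.pi * w) : ℂ)) := (hg.comp_mul_left' hpi).ofReal
  have h3 : Integrable (𝓕 (fun x => (f x : ℂ))) := h2.congr (h1.mono fun w hw => hw.symm)
  have h4 := Continuous.fourierInv_fourier_eq (f := fun x => (f x : ℂ)) (by fun_prop)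
    hf.ofReal h3
  funext x
  have h5 : 𝓕⁻ (𝓕 (fun x => (f x : ℂ))) x = (f x : ℂ) := congrFun h4 x
  rw [← Complex.ofReal_inj, ← h5, ofReal_invFourierRe heven, Real.fourierInv_eq',
    ← integral_neg_eq_self]
  have h6 : ∫ w : ℝ, (fun ξ : ℝ => Complex.exp (-Complex.I * ((-ξ : ℝ) : ℂ) * (x : ℂ)) *
      (g (-ξ) : ℂ)) (2 * Real.pi * w) = |(2 * Real.pi)⁻¹| • ∫ ξ : ℝ,
      Complex.exp (-Complex.I * ((-ξ : ℝ) : ℂ) * (x : ℂ)) * (g (-ξ) : ℂ) :=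
    Measure.integral_comp_mul_left (fun ξ : ℝ => Complex.exp (-Complex.I * ((-ξ : ℝ) : ℂ) *
      (x : ℂ)) * (g (-ξ) : ℂ)) (2 * Real.pi)
  rw [abs_of_pos (by positivity), Complex.real_smul] at h6
  rw [one_div]
  push_cast at h6 ⊢
  rw [← h6]
  refine integral_congr_ae ?_
  filter_upwards [h1] with w hw
  rw [hw, heven]
  simp only [smul_eq_mul, RCLike.inner_apply, conj_trivial]
  congr 2
  push_cast
  ring

end

end FourierTransform

/-! ### Stieltjes functions and the quotient theorem -/

/-- `H(b) = ∫ (1 - t + b t)⁻¹ κ(dt)` for `b > 0` with a finite measure `κ` on `[0, 1]`; with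
`t = (1 + s)⁻¹` these are the Stieltjes functions, including the constants. -/
def IsStieltjesFunction (H : ℝ → ℝ) : Prop :=
  ∃ κ : Measure ℝ, IsFiniteMeasure κ ∧ κ (Icc 0 1)ᶜ = 0 ∧
    ∀ b : ℝ, 0 < b → H b = ∫ t, (1 - t + b * t)⁻¹ ∂κ

/-- Stieltjes functions are closed under bounded pointwise limits. -/
theorem IsStieltjesFunction.of_tendsto {H : ℕ → ℝ → ℝ} {H' : ℝ → ℝ} {C : ℝ}
    (h : ∀ n, IsStieltjesFunction (H n)) (hC : ∀ n, H n 1 ≤ C)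
    (hlim : ∀ b, 0 < b → Tendsto (fun n => H n b) atTop (𝓝 (H' b))) :
    IsStieltjesFunction H' := by
  choose κ hfin hsupp hH using h
  let κ' : ℕ → FiniteMeasure ℝ := fun n => ⟨κ n, hfin n⟩
  have hC0 : 0 ≤ C := by
    refine le_trans ?_ (hC 0)
    rw [hH 0 1 one_pos]
    simp
  -- At b = 1 the integrand is identically 1, so `H n 1` is the total mass of `κ n`.
  have hmem : ∀ n, κ' n ∈ {μ : FiniteMeasure ℝ | μ.mass ≤ C.toNNReal ∧ μ (Icc 0 1)ᶜ = 0} := by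
    intro n
    refine ⟨?_, ?_⟩
    · rw [← NNReal.coe_le_coe, Real.coe_toNNReal _ hC0]
      refine le_trans (le_of_eq ?_) (hC n)
      rw [hH n 1 one_pos]
      simp [FiniteMeasure.mass, κ', measureReal_def]
      rfl
    · rw [FiniteMeasure.null_iff_toMeasure_null]
      exact hsupp n
  have hK := isCompact_setOfPred_finiteMeasure_le_of_isCompact C.toNNReal
    (isCompact_Icc (a := (0 : ℝ)) (b := 1))
  obtain ⟨μ, hμ, hμlim⟩ := hK.ultrafilter_le_nhds' ((hyperfilter ℕ).map κ')
    (Ultrafilter.mem_map.2 (Filter.univ_mem' hmem))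
  refine ⟨μ, inferInstance, (FiniteMeasure.null_iff_toMeasure_null _ _).1 hμ.2, fun b hb => ?_⟩
  -- Clamping t to [0, 1] turns the integrand into a bounded continuous function on ℝ, as weak
  -- convergence requires. The integrals do not change, as the measures live on [0, 1].
  have hclamp : ∀ t : ℝ, min 1 b ≤ 1 - (max 0 (min 1 t)) + b * (max 0 (min 1 t)) := by
    intro t
    have h0 : 0 ≤ max 0 (min 1 t) := le_max_left _ _
    have h1 : max 0 (min 1 t) ≤ 1 := max_le zero_le_one (min_le_left _ _)
    generalize max 0 (min 1 t) = u at h0 h1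
    have := min_le_left 1 b
    have := min_le_right 1 b
    nlinarith
  have hmin : 0 < min 1 b := lt_min one_pos hb
  let f : BoundedContinuousFunction ℝ ℝ := BoundedContinuousFunction.ofNormedAddCommGroup
    (fun t => (1 - (max 0 (min 1 t)) + b * (max 0 (min 1 t)))⁻¹)
    (Continuous.inv₀ (by fun_prop) fun t => (hmin.trans_le (hclamp t)).ne') (min 1 b)⁻¹
    (fun t => by
      rw [norm_inv, Real.norm_of_nonneg (hmin.le.trans (hclamp t))]
      exact inv_anti₀ hmin (hclamp t))
  have hf : ∀ (ρ : Measure ℝ), ρ (Icc 0 1)ᶜ = 0 →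
      ∫ t, f t ∂ρ = ∫ t, (1 - t + b * t)⁻¹ ∂ρ := by
    intro ρ hρ
    refine integral_congr_ae ?_
    filter_upwards [compl_mem_ae_iff.2 hρ] with t ht
    rw [compl_compl] at ht
    change (1 - (max 0 (min 1 t)) + b * (max 0 (min 1 t)))⁻¹ = _
    rw [min_eq_right ht.2, max_eq_right ht.1]
  have h1 : Tendsto (fun n => ∫ t, f t ∂(κ' n : Measure ℝ)) (hyperfilter ℕ)
      (𝓝 (∫ t, f t ∂(μ : Measure ℝ))) :=
    FiniteMeasure.tendsto_iff_forall_integral_tendsto.1 (hμlim : Tendsto κ' _ _) f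
  have h2 : Tendsto (fun n => ∫ t, f t ∂(κ' n : Measure ℝ)) (hyperfilter ℕ) (𝓝 (H' b)) := by
    refine ((hlim b hb).mono_left Nat.hyperfilter_le_atTop).congr fun n => ?_
    rw [hH n b hb]
    exact (hf _ (hsupp n)).symm
  rw [tendsto_nhds_unique h2 h1]
  exact hf _ ((FiniteMeasure.null_iff_toMeasure_null _ _).1 hμ.2)

/-- The finite-dimensional Sherman-Morrison formula, diagonalized. -/
theorem exists_sum_resolvent {ι : Type*} [Fintype ι] [DecidableEq ι] {a c : ℝ} (ha : 0 < a)
    (hc : 0 < c) {w s : ι → ℝ} (hw : ∀ i, 0 ≤ w i) (hs : ∀ i, 0 ≤ s i) :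
    ∃ p m : ι → ℝ, (∀ k, 0 ≤ p k) ∧ (∀ k, 0 ≤ m k) ∧ ∀ b, 0 < b →
      (∑ i, w i / ((s i + a) * (s i + b))) / (c + ∑ i, w i / (s i + b))
        = ∑ k, p k / ((m k + a) * (m k + b)) := by
  set e : ι → ℝ := fun i => Real.sqrt (w i) with he
  set A : Matrix ι ι ℝ := Matrix.diagonal s + c⁻¹ • Matrix.vecMulVec e e with hA
  have hpsd : A.PosSemidef := by
    refine (Matrix.PosSemidef.diagonal hs).add (Matrix.PosSemidef.smul ?_ (by positivity))
    simpa using Matrix.posSemidef_vecMulVec_self_star e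
  have hherm := hpsd.isHermitian
  set u := hherm.eigenvectorBasis with hu
  set m := hherm.eigenvalues with hm
  have hm0 : ∀ k, 0 ≤ m k := hpsd.eigenvalues_nonneg
  set S : ℝ → ℝ := fun b => c + ∑ i, w i / (s i + b) with hS
  have hSpos : ∀ b, 0 < b → 0 < S b := fun b hb => add_pos_of_pos_of_nonneg hc
    (Finset.sum_nonneg fun i _ => div_nonneg (hw i) (by linarith [hs i]))
  -- Sherman-Morrison: (A + b)⁻¹e is a multiple of (diag s + b)⁻¹e, because the rank one part of A
  -- maps into the span of e.
  set x : ℝ → ι → ℝ := fun b i => c / S b * (e i / (s i + b)) with hx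
  have hee : ∀ i, e i * e i = w i := fun i => Real.mul_self_sqrt (hw i)
  have hsolve : ∀ b, 0 < b → A.mulVec (x b) + b • x b = e := by
    intro b hb
    have h1 : e ⬝ᵥ x b = c / S b * ∑ i, w i / (s i + b) := by
      rw [dotProduct, Finset.mul_sum]
      refine Finset.sum_congr rfl fun i _ => ?_
      rw [hx, ← hee i]; ring
    funext i
    rw [hA, Matrix.add_mulVec, Matrix.smul_mulVec, Matrix.vecMulVec_mulVec]
    simp only [Pi.add_apply, Matrix.mulVec_diagonal, Pi.smul_apply, smul_eq_mul, h1,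
      MulOpposite.smul_eq_mul_unop, MulOpposite.unop_op]
    have h2 : S b ≠ 0 := (hSpos b hb).ne'
    have h3 : s i + b ≠ 0 := by linarith [hs i]
    have h4 : S b = c + ∑ i, w i / (s i + b) := rfl
    generalize hq : ∑ i, w i / (s i + b) = q at h4
    have hx' : x b i = c / S b * (e i / (s i + b)) := rfl
    rw [hx']
    field_simp
    rw [h4]
    ring
  have hsymm : A.transpose = A := by simpa [Matrix.IsHermitian] using hherm
  have hcoef : ∀ k b, 0 < b → (u k : ι → ℝ) ⬝ᵥ e = (m k + b) * ((u k : ι → ℝ) ⬝ᵥ x b) := by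
    intro k b hb
    have h1 : A.mulVec (u k) = m k • (u k : ι → ℝ) := hherm.mulVec_eigenvectorBasis k
    conv_lhs => rw [← hsolve b hb]
    rw [dotProduct_add, Matrix.dotProduct_mulVec, ← Matrix.mulVec_transpose, hsymm, h1,
      smul_dotProduct, dotProduct_smul, smul_eq_mul, smul_eq_mul]
    ring
  -- The quotient equals (S(a)/c²)⟨(A + a)⁻¹e, (A + b)⁻¹e⟩. Expanding in the eigenbasis `u` gives
  -- nonnegative coefficients, and the eigenvalues are the new poles.
  refine ⟨fun k => S a / c ^ 2 * ((u k : ι → ℝ) ⬝ᵥ e) ^ 2, m, fun k => ?_, hm0, fun b hb => ?_⟩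
  · have := hSpos a ha
    positivity
  have hpars : x a ⬝ᵥ x b = ∑ k, ((u k : ι → ℝ) ⬝ᵥ x a) * ((u k : ι → ℝ) ⬝ᵥ x b) := by
    have h := u.sum_inner_mul_inner (WithLp.toLp 2 (x a)) (WithLp.toLp 2 (x b))
    simp only [EuclideanSpace.inner_eq_star_dotProduct, star_trivial] at h
    rw [dotProduct_comm, ← h]
    refine Finset.sum_congr rfl fun k _ => ?_
    rw [dotProduct_comm (x b)]
  have hleft : x a ⬝ᵥ x b = c ^ 2 / (S a * S b) * ∑ i, w i / ((s i + a) * (s i + b)) := by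
    rw [dotProduct, Finset.mul_sum]
    refine Finset.sum_congr rfl fun i _ => ?_
    rw [hx, ← hee i]
    simp only [div_eq_mul_inv, mul_inv]
    ring
  have hSa := (hSpos a ha).ne'
  have hSb := (hSpos b hb).ne'
  have hgoal : (∑ i, w i / ((s i + a) * (s i + b))) / S b = S a / c ^ 2 * (x a ⬝ᵥ x b) := by
    rw [hleft]; field_simp
  change _ / S b = _
  rw [hgoal, hpars, Finset.mul_sum]
  refine Finset.sum_congr rfl fun k _ => ?_
  have h1 : m k + a ≠ 0 := by linarith [hm0 k]
  have h2 : m k + b ≠ 0 := by linarith [hm0 k]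
  have h3 : ((u k : ι → ℝ) ⬝ᵥ e) ^ 2 = ((m k + a) * ((u k : ι → ℝ) ⬝ᵥ x a)) *
      ((m k + b) * ((u k : ι → ℝ) ⬝ᵥ x b)) := by
    rw [← hcoef k a ha, ← hcoef k b hb, sq]
  beta_reduce
  rw [h3]
  field_simp

/-- The pole -m becomes a point mass at t = 1/(1 + m), where 1 - t + bt = (m + b)/(1 + m). -/
theorem isStieltjesFunction_sum_quotient {ι : Type*} [Fintype ι] {a c : ℝ} (ha : 0 < a)
    (hc : 0 < c) {w s : ι → ℝ} (hw : ∀ i, 0 ≤ w i) (hs : ∀ i, 0 ≤ s i) :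
    IsStieltjesFunction fun b =>
      (∑ i, w i / ((s i + a) * (s i + b))) / (c + ∑ i, w i / (s i + b)) := by
  classical
  obtain ⟨p, m, hp, hm, h⟩ := exists_sum_resolvent ha hc hw hs
  have hq : ∀ k, 0 ≤ p k / ((m k + a) * (1 + m k)) := fun k =>
    div_nonneg (hp k) (by have := hm k; positivity)
  refine ⟨∑ k, (p k / ((m k + a) * (1 + m k))).toNNReal • Measure.dirac (1 + m k)⁻¹,
    inferInstance, ?_, fun b hb => ?_⟩
  · rw [Measure.finsetSum_apply]
    refine Finset.sum_eq_zero fun k _ => ?_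
    have := hm k
    rw [Measure.smul_apply, Measure.dirac_apply' _ measurableSet_Icc.compl, indicator_of_notMem,
      smul_zero]
    rw [mem_compl_iff, not_not]
    exact ⟨by positivity, inv_le_one_of_one_le₀ (by linarith)⟩
  · beta_reduce
    rw [h b hb, integral_finsetSum_measure]
    · refine Finset.sum_congr rfl fun k _ => ?_
      rw [integral_smul_nnreal_measure, integral_dirac, NNReal.smul_def, Real.coe_toNNReal _ (hq k),
        smul_eq_mul]
      have := hm k
      have h1 : 1 + m k ≠ 0 := by positivity
      have h2 : m k + b ≠ 0 := by positivity
      have h3 : m k + a ≠ 0 := by positivity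
      have h4 : 1 - (1 + m k)⁻¹ + b * (1 + m k)⁻¹ = (m k + b) / (1 + m k) := by
        field_simp; ring
      rw [h4]
      field_simp
    · intro k _
      exact (integrable_dirac (by finiteness)).smul_measure_nnreal

theorem abs_one_add_div_le {b s : ℝ} (hb : 0 < b) (hs : 0 ≤ s) :
    |(1 + s) / (s + b)| ≤ 1 + b⁻¹ := by
  rw [abs_of_nonneg (by positivity), div_le_iff₀ (by positivity)]
  have : b⁻¹ * b = 1 := inv_mul_cancel₀ hb.ne'
  have : 0 ≤ b⁻¹ * s := by positivity
  nlinarith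

theorem integrable_one_add_div {ν : Measure ℝ} [IsFiniteMeasure ν] (hν : ν (Iio 0) = 0) {b : ℝ}
    (hb : 0 < b) : Integrable (fun s => (1 + s) / (s + b)) ν := by
  refine (integrable_const (1 + b⁻¹)).mono'
        (Measurable.aestronglyMeasurable (by fun_prop)) ?_
  filter_upwards [compl_mem_ae_iff.2 hν] with s hs
  exact abs_one_add_div_le hb (by simpa using hs)

theorem one_add_div_mul_le {a b s : ℝ} (ha : 0 < a) (hb : 0 < b) (hs : 0 ≤ s) :
    (1 + s) / ((s + a) * (s + b)) ≤ a⁻¹ * ((1 + s) / (s + b)) := by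
  rw [← div_eq_inv_mul, div_div, mul_comm (s + b)]
  gcongr
  linarith

theorem integrable_one_add_div_mul {ν : Measure ℝ} [IsFiniteMeasure ν] (hν : ν (Iio 0) = 0)
    {a b : ℝ} (ha : 0 < a) (hb : 0 < b) :
    Integrable (fun s => (1 + s) / ((s + a) * (s + b))) ν := by
  refine ((integrable_one_add_div hν hb).const_mul a⁻¹).mono'
        (Measurable.aestronglyMeasurable (by fun_prop)) ?_
  filter_upwards [compl_mem_ae_iff.2 hν] with s hs
  have hs' : 0 ≤ s := by simpa using hs
  rw [Real.norm_of_nonneg (by positivity)]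
  exact one_add_div_mul_le ha hb hs'

/-- Integrals over a finite measure on `[0, ∞)` are limits of finite sums, uniformly over all
bounded continuous integrands. -/
theorem exists_discretization {ν : Measure ℝ} [IsFiniteMeasure ν] (hν : ν (Iio 0) = 0) :
    ∃ (φ : ℕ → SimpleFunc ℝ ℝ) (w : (n : ℕ) → (φ n).range → ℝ),
      (∀ (n : ℕ) (y : (φ n).range), 0 ≤ (y : ℝ)) ∧ (∀ n y, 0 ≤ w n y) ∧
      ∀ (f : ℝ → ℝ) (C : ℝ), ContinuousOn f (Ici 0) → Measurable f → (∀ s, 0 ≤ s → |f s| ≤ C) →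
        Tendsto (fun n => ∑ y : (φ n).range, w n y * f y) atTop (𝓝 (∫ s, f s ∂ν)) := by
  let φ : ℕ → SimpleFunc ℝ ℝ := fun n =>
    SimpleFunc.approxOn (id : ℝ → ℝ) measurable_id (Ici 0) 0 (mem_Ici.2 le_rfl) n
  -- The measure ν is pushed forward along simple approximations of the identity with values in [0,
  -- ∞). Landing in the finite type of values turns the integral into a finite sum.
  let Φ : (n : ℕ) → ℝ → (φ n).range := fun n s => ⟨φ n s, SimpleFunc.mem_range_self _ _⟩
  have hΦ : ∀ n, Measurable (Φ n) := fun n => ((φ n).measurable).subtype_mk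
  have hφ0 : ∀ n s, 0 ≤ φ n s := fun n s =>
    SimpleFunc.approxOn_mem measurable_id (mem_Ici.2 le_rfl) n s
  refine ⟨φ, fun n y => (ν.map (Φ n)).real {y}, fun n y => ?_, fun n y => measureReal_nonneg,
    fun f C hf hfm hC => ?_⟩
  · obtain ⟨s, hs⟩ := SimpleFunc.mem_range.1 y.2
    rw [← hs]; exact hφ0 n s
  · have h1 : ∀ n, ∑ y : (φ n).range, (ν.map (Φ n)).real {y} * f y = ∫ s, f (φ n s) ∂ν := by
      intro n
      have : IsFiniteMeasure (ν.map (Φ n)) := Measure.isFiniteMeasure_map _ _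
      have h2 : ∫ y, f (y : ℝ) ∂(ν.map (Φ n)) = ∫ s, f (φ n s) ∂ν :=
        integral_map (hΦ n).aemeasurable
          (hfm.comp measurable_subtype_coe).aestronglyMeasurable
      rw [← h2, integral_fintype (Integrable.of_finite)]
      rfl
    simp only [h1]
    refine tendsto_integral_of_dominated_convergence (fun _ => C) (fun n => ?_)
      (integrable_const C) (fun n => ae_of_all _ fun s => hC _ (hφ0 n s)) ?_
    · exact (hfm.comp (φ n).measurable).aestronglyMeasurable
    · filter_upwards [compl_mem_ae_iff.2 hν] with s hs
      have hs' : s ∈ Ici (0 : ℝ) := by simpa using hs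
      have h2 : Tendsto (fun n => φ n s) atTop (𝓝 s) :=
        SimpleFunc.tendsto_approxOn measurable_id (mem_Ici.2 le_rfl)
          (subset_closure hs')
      have h3 : Tendsto (fun n => φ n s) atTop (𝓝[Ici 0] s) :=
        tendsto_nhdsWithin_iff.2 ⟨h2, Eventually.of_forall fun n => hφ0 n s⟩
      exact (hf s hs').tendsto.comp h3

/-- For `S(b) = c + ∫ (1 + s) / (s + b) ν(ds)`, the quotient `(S(a) - S(b)) / ((b - a) S(b))` is a
Stieltjes function. -/
theorem isStieltjesFunction_integral_quotient {ν : Measure ℝ} [IsFiniteMeasure ν]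
    (hν : ν (Iio 0) = 0) {a c : ℝ} (ha : 0 < a) (hc : 0 ≤ c)
    (hS : ∀ b, 0 < b → 0 < c + ∫ s, (1 + s) / (s + b) ∂ν) :
    IsStieltjesFunction fun b =>
      (∫ s, (1 + s) / ((s + a) * (s + b)) ∂ν) / (c + ∫ s, (1 + s) / (s + b) ∂ν) := by
  obtain ⟨φ, w, hy, hw, hlim⟩ := exists_discretization hν
  -- The matrix argument divides by c, so c ≥ 0 is perturbed to c + 1/(n + 1). The mass bound a⁻¹
  -- comes from 1/(s + a) ≤ 1/a.
  have hcn : ∀ n : ℕ, 0 < c + 1 / ((n : ℝ) + 1) := fun n => by positivity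
  refine IsStieltjesFunction.of_tendsto (C := a⁻¹) (H := fun n b =>
    (∑ y : (φ n).range, w n y * (1 + (y : ℝ)) / (((y : ℝ) + a) * ((y : ℝ) + b))) /
      ((c + 1 / ((n : ℝ) + 1)) + ∑ y : (φ n).range, w n y * (1 + (y : ℝ)) / ((y : ℝ) + b)))
    (fun n => ?_) (fun n => ?_) (fun b hb => ?_)
  · exact isStieltjesFunction_sum_quotient ha (hcn n)
      (fun y => mul_nonneg (hw n y) (by linarith [hy n y])) (hy n)
  · have h0 : 0 ≤ ∑ y : (φ n).range, w n y * (1 + (y : ℝ)) / ((y : ℝ) + 1) :=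
      Finset.sum_nonneg fun y _ =>
        div_nonneg (mul_nonneg (hw n y) (by linarith [hy n y])) (by linarith [hy n y])
    rw [div_le_iff₀ (by linarith [hcn n]), mul_add]
    have h1 : ∑ y : (φ n).range, w n y * (1 + (y : ℝ)) / (((y : ℝ) + a) * ((y : ℝ) + 1)) ≤
        a⁻¹ * ∑ y : (φ n).range, w n y * (1 + (y : ℝ)) / ((y : ℝ) + 1) := by
      rw [Finset.mul_sum]
      refine Finset.sum_le_sum fun y _ => ?_
      rw [mul_div_assoc, mul_div_assoc, mul_left_comm]
      exact mul_le_mul_of_nonneg_left (one_add_div_mul_le ha one_pos (hy n y)) (hw n y)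
    have : 0 ≤ a⁻¹ * (c + 1 / ((n : ℝ) + 1)) := mul_nonneg (by positivity) (hcn n).le
    linarith
  · refine Tendsto.div ?_ ?_ (hS b hb).ne'
    · have := hlim (fun s => (1 + s) / ((s + a) * (s + b))) (a⁻¹ * (1 + b⁻¹)) ?_ (by fun_prop) ?_
      · simpa only [mul_div_assoc] using this
      · intro s hs
        have h1 : (s + a) * (s + b) ≠ 0 := by
          have := mem_Ici.1 hs; positivity
        exact ContinuousAt.continuousWithinAt (by fun_prop (disch := assumption))
      · intro s hs
        rw [abs_of_nonneg (by positivity)]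
        refine (one_add_div_mul_le ha hb hs).trans ?_
        exact mul_le_mul_of_nonneg_left ((le_abs_self _).trans (abs_one_add_div_le hb hs))
          (by positivity)
    · have h1 := hlim (fun s => (1 + s) / (s + b)) (1 + b⁻¹) ?_ (by fun_prop)
        (fun s hs => abs_one_add_div_le hb hs)
      · have h2 : Tendsto (fun n : ℕ => c + 1 / ((n : ℝ) + 1)) atTop (𝓝 c) := by
          simpa using tendsto_one_div_add_atTop_nhds_zero_nat.const_add c
        have := h2.add h1
        simpa only [mul_div_assoc] using this
      · intro s hs
        have h1 : s + b ≠ 0 := by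
          have := mem_Ici.1 hs; positivity
        exact ContinuousAt.continuousWithinAt (by fun_prop (disch := assumption))

/-- The difference quotients of a complete Bernstein function are Stieltjes functions. -/
theorem IsCompleteBernstein.exists_difference_quotient {ψ : ℝ → ℝ} (hψ : IsCompleteBernstein ψ)
    {a : ℝ} (ha : 0 < a) : ∃ (c : ℝ) (ν : Measure ℝ), 0 ≤ c ∧ IsFiniteMeasure ν ∧
      ν (Iio 0) = 0 ∧ ∀ b, 0 < b → ψ b - ψ a = (b - a) * (c + ∫ s, (1 + s) / (s + b) ∂ν) := by
  obtain ⟨c₁, c₂, m, -, hc₂, hm0, hmfin, hrep⟩ := hψ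
  have hpos : ∀ᵐ s ∂m, 0 < s := by
    filter_upwards [compl_mem_ae_iff.2 hm0] with s hs
    simpa using hs
  have hmin : Integrable (fun s : ℝ => min s⁻¹ (s ^ 2)⁻¹) m := by
    refine ⟨by fun_prop, ?_⟩
    rw [hasFiniteIntegral_iff_ofReal]
    · exact hmfin
    · filter_upwards [hpos] with s hs
      exact le_min (by positivity) (by positivity)
  have hint : ∀ b, 0 < b → Integrable (fun s => b / (b + s) / s) m := by
    intro b hb
    refine (hmin.const_mul (1 + b)).mono'
        (Measurable.aestronglyMeasurable (by fun_prop)) ?_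
    filter_upwards [hpos] with s hs
    rw [Real.norm_of_nonneg (by positivity), mul_min_of_nonneg _ _ (by positivity)]
    refine le_min ?_ ?_
    · rw [← div_eq_mul_inv]
      gcongr
      rw [div_le_iff₀ (by positivity)]
      nlinarith
    · rw [← div_eq_mul_inv, div_div, div_le_div_iff₀ (by positivity) (by positivity)]
      have : 0 < b * b * s := by positivity
      have : 0 < b * s := by positivity
      have : 0 < s * (b * s) := by positivity
      have : 0 < s * s := by positivity
      nlinarith
  -- The integrands at b and a differ by (b - a)/((s + a)(s + b)). The weight 1 + s is split off so
  -- that the remaining density is O(min(s⁻¹, s⁻²)), which makes ν finite.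
  set ρ : ℝ → ℝ := fun s => (1 / Real.pi) / ((s + a) * (1 + s)) with hρ
  have hρ0 : ∀ s, 0 < s → 0 ≤ ρ s := fun s hs => by
    have := Real.pi_pos
    positivity
  have hρm : Measurable ρ := by fun_prop
  have hρint : Integrable ρ m := by
    refine (hmin.const_mul ((1 / Real.pi) * (1 + a⁻¹))).mono' hρm.aestronglyMeasurable ?_
    filter_upwards [hpos] with s hs
    rw [Real.norm_of_nonneg (hρ0 s hs), hρ, mul_assoc]
    beta_reduce
    rw [div_eq_mul_inv]
    refine mul_le_mul_of_nonneg_left ?_ (by have := Real.pi_pos; positivity)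
    have h1 : a⁻¹ * a = 1 := inv_mul_cancel₀ ha.ne'
    have h2 : 0 < a⁻¹ := by positivity
    rw [mul_min_of_nonneg _ _ (by positivity)]
    refine le_min ?_ ?_ <;>
    · rw [← div_eq_mul_inv, inv_eq_one_div, div_le_div_iff₀ (by positivity) (by positivity)]
      have h3 : (1 + a⁻¹) * ((s + a) * (1 + s)) = s * s + s + a + a * s + a⁻¹ * s * s + a⁻¹ * s
          + a⁻¹ * a + (a⁻¹ * a) * s := by ring
      rw [h3, h1]
      have : 0 < a⁻¹ * s := by positivity
      have : 0 < a⁻¹ * s * s := by positivity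
      have : 0 < a * s := by positivity
      nlinarith
  refine ⟨c₂, m.withDensity fun s => ENNReal.ofReal (ρ s), hc₂,
    isFiniteMeasure_withDensity_ofReal hρint.2, ?_, fun b hb => ?_⟩
  · exact withDensity_absolutelyContinuous _ _ (measure_mono_null Iio_subset_Iic_self hm0)
  · have h1 : ∫ s, (1 + s) / (s + b) ∂(m.withDensity fun s => ENNReal.ofReal (ρ s))
        = ∫ s, (1 / Real.pi) * (1 / ((s + a) * (s + b))) ∂m := by
      rw [integral_withDensity_eq_integral_toReal_smul (by fun_prop)
        (ae_of_all _ fun s => ENNReal.ofReal_lt_top)]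
      refine integral_congr_ae ?_
      filter_upwards [hpos] with s hs
      rw [ENNReal.toReal_ofReal (hρ0 s hs), hρ, smul_eq_mul]
      have := Real.pi_pos
      field_simp
    rw [hrep b hb, hrep a ha, h1, integral_const_mul]
    have h2 : (∫ s, b / (b + s) / s ∂m) - ∫ s, a / (a + s) / s ∂m
        = (b - a) * ∫ s, 1 / ((s + a) * (s + b)) ∂m := by
      rw [← integral_sub (hint b hb) (hint a ha), ← integral_const_mul]
      refine integral_congr_ae ?_
      filter_upwards [hpos] with s hs
      field_simp
      ring
    linear_combination (1 / Real.pi) * h2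

/-- Here H = N/S. The poles at ±λ cancel algebraically, since Ψ'(λ) = 2λ S(λ²). The bound on H
follows from 1/(s + a) ≤ 1/a under the integral. -/
theorem IsRegularExponent.exists_stieltjes_thetaKernel {Ψ : ℝ → ℝ} {lam : ℝ}
    (h : IsRegularExponent Ψ) (hlam : 0 < lam)
    {ψ : ℝ → ℝ} (hψ : IsCompleteBernstein ψ) (hΨψ : ∀ ξ : ℝ, 0 < ξ → Ψ ξ = ψ (ξ ^ 2)) :
    ∃ H : ℝ → ℝ, IsStieltjesFunction H ∧ (∀ b, 0 < b → 0 ≤ H b) ∧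
      (∀ b, 0 < b → H b ≤ (lam ^ 2)⁻¹) ∧
      ∀ ξ, 0 < ξ → ξ ≠ lam → thetaKernel Ψ lam ξ = 2 * lam * H (ξ ^ 2) := by
  have ha : 0 < lam ^ 2 := by positivity
  obtain ⟨c, ν, hc, hfin, hν, hquot⟩ := hψ.exists_difference_quotient ha
  set a := lam ^ 2 with ha'
  set S : ℝ → ℝ := fun b => c + ∫ s, (1 + s) / (s + b) ∂ν with hS
  set N : ℝ → ℝ := fun b => ∫ s, (1 + s) / ((s + a) * (s + b)) ∂ν with hN
  have hν' : ∀ᵐ s ∂ν, 0 ≤ s := by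
    filter_upwards [compl_mem_ae_iff.2 hν] with s hs
    simpa using hs
  have hSN : ∀ b, 0 < b → S a - S b = (b - a) * N b := by
    intro b hb
    simp only [hS, hN]
    rw [add_sub_add_left_eq_sub, ← integral_sub (integrable_one_add_div hν ha)
      (integrable_one_add_div hν hb), ← integral_const_mul]
    refine integral_congr_ae ?_
    filter_upwards [hν'] with s hs
    field_simp
    ring
  have hN0 : ∀ b, 0 < b → 0 ≤ N b := fun b hb => integral_nonneg_of_ae <| by
    filter_upwards [hν'] with s hs
    simp only [Pi.zero_apply]
    positivity
  have hI0 : ∀ b, 0 < b → 0 ≤ ∫ s, (1 + s) / (s + b) ∂ν := fun b hb => integral_nonneg_of_ae <| by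
    filter_upwards [hν'] with s hs
    simp only [Pi.zero_apply]
    positivity
  have hNS : ∀ b, 0 < b → N b ≤ a⁻¹ * S b := by
    intro b hb
    have h1 : N b ≤ a⁻¹ * ∫ s, (1 + s) / (s + b) ∂ν := by
      rw [← integral_const_mul]
      refine integral_mono_ae (integrable_one_add_div_mul hν ha hb)
        ((integrable_one_add_div hν hb).const_mul _) ?_
      filter_upwards [hν'] with s hs using one_add_div_mul_le ha hb hs
    refine h1.trans (mul_le_mul_of_nonneg_left ?_ (by positivity))
    exact le_add_of_nonneg_left hc
  have hScont : Tendsto S (𝓝 a) (𝓝 (S a)) := by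
    refine Tendsto.const_add c ?_
    refine tendsto_integral_filter_of_dominated_convergence (fun _ => 1 + (a / 2)⁻¹)
      (Eventually.of_forall fun b => Measurable.aestronglyMeasurable (by fun_prop)) ?_ (integrable_const _) ?_
    · filter_upwards [lt_mem_nhds (half_lt_self ha)] with b hb
      filter_upwards [hν'] with s hs
      refine (abs_one_add_div_le (by linarith : 0 < b) hs).trans ?_
      gcongr
    · filter_upwards [hν'] with s hs
      have : s + a ≠ 0 := by positivity
      exact ContinuousAt.tendsto (by fun_prop (disch := assumption) :
        ContinuousAt (fun b => (1 + s) / (s + b)) a)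
  have hΨS : ∀ ξ, 0 < ξ → Ψ ξ - Ψ lam = (ξ ^ 2 - a) * S (ξ ^ 2) := fun ξ hξ => by
    rw [hΨψ ξ hξ, hΨψ lam hlam, hquot (ξ ^ 2) (by positivity)]
  have hderiv : deriv Ψ lam = 2 * lam * S a := by
    have h1 := hasDerivAt_iff_tendsto_slope.1 (h.differentiableAt hlam).hasDerivAt
    have h2 : Tendsto (fun ξ => (ξ + lam) * S (ξ ^ 2)) (𝓝[≠] lam) (𝓝 ((lam + lam) * S a)) := by
      refine Tendsto.mono_left ?_ nhdsWithin_le_nhds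
      refine Tendsto.mul (tendsto_id.add_const lam) (hScont.comp ?_)
      exact (continuous_pow 2).tendsto lam
    rw [two_mul]
    refine tendsto_nhds_unique (h1.congr' ?_) h2
    filter_upwards [self_mem_nhdsWithin, nhdsWithin_le_nhds (lt_mem_nhds hlam)] with ξ hne hξ
    have hne' : ξ - lam ≠ 0 := sub_ne_zero.2 hne
    rw [slope_def_field, hΨS ξ hξ, div_eq_iff hne']
    ring
  -- A zero of S at b ≠ a would force Ψ(√b) = Ψ(λ), against strict monotonicity. At b = a positivity
  -- is Ψ'(λ) > 0.
  have hSpos : ∀ b, 0 < b → 0 < S b := by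
    have hSa : 0 < S a := by
      have := h.deriv_pos lam hlam
      rw [hderiv] at this
      exact pos_of_mul_pos_right this (by positivity)
    intro b hb
    by_cases hba : b = a
    · rw [hba]; exact hSa
    · have h1 := hΨS (Real.sqrt b) (Real.sqrt_pos.2 hb)
      rw [Real.sq_sqrt hb.le] at h1
      have h2 : S b ≠ 0 := by
        intro h0
        rw [h0, mul_zero] at h1
        refine h.apply_ne hlam (Real.sqrt_nonneg b) (fun h3 => hba ?_) (by linarith)
        rw [ha', ← h3, Real.sq_sqrt hb.le]
      exact lt_of_le_of_ne (add_nonneg hc (hI0 b hb)) h2.symm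
  refine ⟨fun b => N b / S b, isStieltjesFunction_integral_quotient hν ha hc hSpos,
    fun b hb => div_nonneg (hN0 b hb) (hSpos b hb).le, fun b hb => ?_, fun ξ hξ hne => ?_⟩
  · rw [div_le_iff₀ (hSpos b hb)]
    exact hNS b hb
  · have hb : 0 < ξ ^ 2 := by positivity
    have h1 : a - ξ ^ 2 ≠ 0 := by
      intro h0
      exact hne ((sq_eq_sq₀ hξ.le hlam.le).1 (by linarith))
    have h2 := (hSpos _ hb).ne'
    have h3 := hΨS ξ hξ
    have h4 : Ψ lam - Ψ ξ = (a - ξ ^ 2) * S (ξ ^ 2) := by linear_combination -h3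
    have h5 := hSN (ξ ^ 2) hb
    rw [thetaKernel, h4, hderiv, ← ha']
    beta_reduce
    field_simp
    linear_combination (-1 : ℝ) * h5

/-! ### The kernel as a mixture of Cauchy kernels -/

theorem two_mul_div_sq_add_sq_eq {α : ℝ} (hα : 0 < α) (ξ : ℝ) :
    2 * α / (α ^ 2 + ξ ^ 2) = 2 / α * (1 + (ξ / α) ^ 2)⁻¹ := by
  field_simp

theorem integrable_two_mul_div_sq_add_sq {α : ℝ} (hα : 0 < α) :
    Integrable fun ξ : ℝ => 2 * α / (α ^ 2 + ξ ^ 2) := by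
  simp only [two_mul_div_sq_add_sq_eq hα]
  exact (integrable_inv_one_add_sq.comp_div hα.ne').const_mul _

theorem integral_two_mul_div_sq_add_sq {α : ℝ} (hα : 0 < α) :
    ∫ ξ : ℝ, 2 * α / (α ^ 2 + ξ ^ 2) = 2 * Real.pi := by
  simp only [two_mul_div_sq_add_sq_eq hα]
  rw [integral_const_mul, Measure.integral_comp_div (fun x : ℝ => (1 + x ^ 2)⁻¹),
    integral_univ_inv_one_add_sq, abs_of_pos hα, smul_eq_mul]
  field_simp

theorem two_mul_div_sq_add_sq_le {α ξ : ℝ} (hα : 0 < α) (hξ : 0 < ξ) :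
    2 * α / (α ^ 2 + ξ ^ 2) ≤ ξ⁻¹ := by
  rw [inv_eq_one_div, div_le_div_iff₀ (by positivity) hξ]
  nlinarith [sq_nonneg (α - ξ)]

theorem integrable_two_mul_div_sq_add_sq_left {γ : Measure ℝ} [IsFiniteMeasure γ]
    (hγ : γ (Iic 0) = 0) {ξ : ℝ} (hξ : 0 < ξ) :
    Integrable (fun α : ℝ => 2 * α / (α ^ 2 + ξ ^ 2)) γ := by
  refine (integrable_const ξ⁻¹).mono' (Measurable.aestronglyMeasurable (by fun_prop)) ?_
  filter_upwards [compl_mem_ae_iff.2 hγ] with α hα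
  have hα' : 0 < α := by simpa using hα
  rw [Real.norm_of_nonneg (by positivity)]
  exact two_mul_div_sq_add_sq_le hα' hξ

/-- A Stieltjes function `H` for which `H(ξ²)` is integrable and bounded has a representation
`2λ H(ξ²) = ∫ 2α / (α² + ξ²) γ(dα)` with a finite measure `γ` on `(0, ∞)` that integrates `1/α`. -/
theorem IsStieltjesFunction.exists_measure {H : ℝ → ℝ} (hH : IsStieltjesFunction H) {lam C : ℝ}
    (hlam : 0 < lam) (hC : ∀ b, 0 < b → H b ≤ C) (hint : Integrable fun ξ : ℝ => H (ξ ^ 2)) :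
    ∃ γ : Measure ℝ, IsFiniteMeasure γ ∧ γ (Iic 0) = 0 ∧ Integrable (fun α => 2 / α) γ ∧
      ∀ ξ, 0 < ξ → 2 * lam * H (ξ ^ 2) = ∫ α, 2 * α / (α ^ 2 + ξ ^ 2) ∂γ := by
  obtain ⟨κ, hfin, hsupp, hrep⟩ := hH
  have hIcc : ∀ᵐ t ∂κ, t ∈ Icc (0 : ℝ) 1 := by
    filter_upwards [compl_mem_ae_iff.2 hsupp] with t ht
    simpa using ht
  have hden : ∀ b, 0 < b → ∀ t ∈ Icc (0 : ℝ) 1, min 1 b ≤ 1 - t + b * t := by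
    intro b hb t ht
    have := min_le_left 1 b
    have := min_le_right 1 b
    nlinarith [ht.1, ht.2]
  have hkpos : ∀ b, 0 < b → ∀ t ∈ Icc (0 : ℝ) 1, 0 ≤ (1 - t + b * t)⁻¹ := fun b hb t ht =>
    inv_nonneg.2 ((lt_min one_pos hb).le.trans (hden b hb t ht))
  have hkint : ∀ b, 0 < b → Integrable (fun t => (1 - t + b * t)⁻¹) κ := by
    intro b hb
    refine (integrable_const (min 1 b)⁻¹).mono' (Measurable.aestronglyMeasurable (by fun_prop)) ?_
    filter_upwards [hIcc] with t ht
    rw [Real.norm_of_nonneg (hkpos b hb t ht)]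
    exact inv_anti₀ (lt_min one_pos hb) (hden b hb t ht)
  have hatom : ∀ b, 0 < b → ∀ t, κ.real {t} * (1 - t + b * t)⁻¹ ≤ H b := by
    intro b hb t
    rw [hrep b hb, ← smul_eq_mul, ← integral_singleton (fun t => (1 - t + b * t)⁻¹)]
    refine setIntegral_le_integral (hkint b hb) ?_
    filter_upwards [hIcc] with t ht using hkpos b hb t ht
  -- An atom at t = 0 would bound H below by a positive constant, which is not integrable over ℝ.
  have hκ0 : κ {0} = 0 := by
    have h1 : ∀ b, 0 < b → κ.real {0} ≤ H b := fun b hb => by simpa using hatom b hb 0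
    have h2 : Integrable (fun _ : ℝ => κ.real {0}) := by
      refine hint.mono' (by fun_prop) ?_
      filter_upwards [compl_mem_ae_iff.2 (measure_singleton (0 : ℝ))] with ξ hξ
      rw [Real.norm_of_nonneg measureReal_nonneg]
      have : ξ ≠ 0 := by simpa using hξ
      exact h1 _ (by positivity)
    have h3 := integrable_const_iff.1 h2
    rcases h3 with h3 | h3
    · exact (measureReal_eq_zero_iff).1 h3
    · exact absurd h3.measure_univ_lt_top (by simp)
  -- An atom at t = 1 contributes a multiple of 1/b, which is unbounded as b ↓ 0.
  have hκ1 : κ {1} = 0 := by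
    refine (measureReal_eq_zero_iff).1 (le_antisymm ?_ measureReal_nonneg)
    have h1 : ∀ b, 0 < b → κ.real {1} ≤ C * b := fun b hb => by
      have h2 := (hatom b hb 1).trans (hC b hb)
      rw [sub_self, zero_add, mul_one, ← div_eq_mul_inv, div_le_iff₀ hb] at h2
      exact h2
    have h2 : Tendsto (fun b : ℝ => C * b) (𝓝[>] 0) (𝓝 (C * 0)) :=
      (tendsto_id.const_mul C).mono_left nhdsWithin_le_nhds
    rw [mul_zero] at h2
    refine ge_of_tendsto h2 ?_
    filter_upwards [self_mem_nhdsWithin] with b hb using h1 b hb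
  have hIoo : ∀ᵐ t ∂κ, t ∈ Ioo (0 : ℝ) 1 := by
    filter_upwards [hIcc, compl_mem_ae_iff.2 hκ0, compl_mem_ae_iff.2 hκ1] with t ht h0 h1
    exact ⟨lt_of_le_of_ne ht.1 (Ne.symm (by simpa using h0)),
      lt_of_le_of_ne ht.2 (by simpa using h1)⟩
  -- The change of variable α = √((1 - t)/t) puts the pole in b at -α². The weight `w` below
  -- normalizes each term to the Cauchy kernel 2α/(α² + ξ²).
  set A : ℝ → ℝ := fun t => Real.sqrt ((1 - t) / t) with hA
  have hAm : Measurable A := by fun_prop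
  have hA0 : ∀ t ∈ Ioo (0 : ℝ) 1, 0 < A t := fun t ht =>
    Real.sqrt_pos.2 (div_pos (by linarith [ht.2]) ht.1)
  have hAsq : ∀ t ∈ Ioo (0 : ℝ) 1, A t ^ 2 = (1 - t) / t := fun t ht =>
    Real.sq_sqrt (div_pos (by linarith [ht.2]) ht.1).le
  set w : ℝ → ℝ := fun t => lam / (t * A t) with hw
  have hwm : Measurable w := by fun_prop
  have hw0 : ∀ t ∈ Ioo (0 : ℝ) 1, 0 < w t := fun t ht =>
    div_pos hlam (mul_pos ht.1 (hA0 t ht))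
  have hkern : ∀ ξ : ℝ, ∀ t ∈ Ioo (0 : ℝ) 1,
      2 * lam * (1 - t + ξ ^ 2 * t)⁻¹ = w t * (2 * A t / (A t ^ 2 + ξ ^ 2)) := by
    intro ξ t ht
    have h1 := hA0 t ht
    have h2 := ht.1
    have h3 : 1 - t + ξ ^ 2 * t = t * (A t ^ 2 + ξ ^ 2) := by
      rw [hAsq t ht]; field_simp
    rw [h3, hw]
    field_simp
  -- By Tonelli 2π times this mass equals ∫ 2λ H(ξ²) dξ, as every Cauchy kernel has integral 2π.
  have hwfin : ∫⁻ t, ENNReal.ofReal (w t) ∂κ ≠ ⊤ := by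
    have h1 : ∀ᵐ ξ : ℝ, ENNReal.ofReal (2 * lam * H (ξ ^ 2))
        = ∫⁻ t, ENNReal.ofReal (2 * lam * (1 - t + ξ ^ 2 * t)⁻¹) ∂κ := by
      filter_upwards [compl_mem_ae_iff.2 (measure_singleton (0 : ℝ))] with ξ hξ
      have hξ' : ξ ≠ 0 := by simpa using hξ
      have hb : 0 < ξ ^ 2 := by positivity
      rw [hrep _ hb, ← integral_const_mul,
        ofReal_integral_eq_lintegral_ofReal ((hkint _ hb).const_mul _)]
      filter_upwards [hIcc] with t ht
      exact mul_nonneg (by positivity) (hkpos _ hb t ht)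
    have h2 : ∫⁻ ξ : ℝ, ENNReal.ofReal (2 * lam * H (ξ ^ 2)) < ⊤ := (hint.const_mul _).lintegral_lt_top
    rw [lintegral_congr_ae h1, lintegral_lintegral_swap] at h2
    · have h3 : ∀ᵐ t ∂κ, ∫⁻ ξ : ℝ, ENNReal.ofReal (2 * lam * (1 - t + ξ ^ 2 * t)⁻¹)
          = ENNReal.ofReal (w t) * ENNReal.ofReal (2 * Real.pi) := by
        filter_upwards [hIoo] with t ht
        have hAt := hA0 t ht
        simp only [hkern _ t ht]
        rw [← ofReal_integral_eq_lintegral_ofReal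
          ((integrable_two_mul_div_sq_add_sq hAt).const_mul _)
          (ae_of_all _ fun ξ => mul_nonneg (hw0 t ht).le (by positivity)), integral_const_mul,
          integral_two_mul_div_sq_add_sq hAt, ENNReal.ofReal_mul (hw0 t ht).le]
      rw [lintegral_congr_ae h3, lintegral_mul_const _ (by fun_prop)] at h2
      intro htop
      rw [htop, ENNReal.top_mul (by simpa using Real.pi_pos)] at h2
      exact lt_irrefl _ h2
    · exact Measurable.aemeasurable (by fun_prop)
  set γ : Measure ℝ := (κ.withDensity fun t => ENNReal.ofReal (w t)).map A with hγ
  have hfinw : IsFiniteMeasure (κ.withDensity fun t => ENNReal.ofReal (w t)) :=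
    isFiniteMeasure_withDensity hwfin
  have hγfin : IsFiniteMeasure γ := Measure.isFiniteMeasure_map _ _
  have hγ0 : γ (Iic 0) = 0 := by
    rw [hγ, Measure.map_apply hAm measurableSet_Iic]
    refine withDensity_absolutelyContinuous _ _ ?_
    have hnull : κ (Ioo 0 1)ᶜ = 0 := mem_ae_iff.1 hIoo
    refine measure_mono_null ?_ hnull
    intro t ht
    rw [mem_compl_iff]
    exact fun hIt => absurd (hA0 t hIt) (not_lt.2 ht)
  have hγrep : ∀ ξ, 0 < ξ → 2 * lam * H (ξ ^ 2) = ∫ α, 2 * α / (α ^ 2 + ξ ^ 2) ∂γ := by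
    intro ξ hξ
    rw [hγ, integral_map hAm.aemeasurable (Measurable.aestronglyMeasurable (by fun_prop)),
      integral_withDensity_eq_integral_toReal_smul (by fun_prop)
        (ae_of_all _ fun s => ENNReal.ofReal_lt_top), hrep _ (by positivity), ← integral_const_mul]
    refine integral_congr_ae ?_
    filter_upwards [hIoo] with t ht
    rw [ENNReal.toReal_ofReal (hw0 t ht).le, smul_eq_mul]
    exact hkern ξ t ht
  refine ⟨γ, hγfin, hγ0, ?_, hγrep⟩
  have hpos : ∀ᵐ α ∂γ, 0 < α := by
    filter_upwards [compl_mem_ae_iff.2 hγ0] with α hα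
    simpa using hα
  refine ⟨Measurable.aestronglyMeasurable (by fun_prop), ?_⟩
  rw [hasFiniteIntegral_iff_ofReal (by filter_upwards [hpos] with α hα; simp only [Pi.zero_apply]; positivity)]
  have hξn : ∀ n : ℕ, 0 < 1 / ((n : ℝ) + 1) := fun n => by positivity
  -- Fatou along ξ = 1/(n + 1) → 0: the Cauchy kernels tend to 2/α, while their γ-integrals equal 2λ
  -- H(ξ²) ≤ 2λ C.
  have h1 : ∫⁻ α, ENNReal.ofReal (2 / α) ∂γ
      = ∫⁻ α, liminf (fun n : ℕ => ENNReal.ofReal (2 * α / (α ^ 2 + (1 / ((n : ℝ) + 1)) ^ 2))) atTop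
          ∂γ := by
    refine lintegral_congr_ae ?_
    filter_upwards [hpos] with α hα
    refine (Tendsto.liminf_eq (ENNReal.tendsto_ofReal ?_)).symm
    have h2 : Tendsto (fun n : ℕ => 2 * α / (α ^ 2 + (1 / ((n : ℝ) + 1)) ^ 2)) atTop
        (𝓝 (2 * α / (α ^ 2 + 0 ^ 2))) :=
      tendsto_const_nhds.div ((tendsto_one_div_add_atTop_nhds_zero_nat.pow 2).const_add _)
        (by positivity)
    convert h2 using 2
    field_simp
    ring
  rw [h1]
  refine (lintegral_liminf_le fun n => by fun_prop).trans_lt ?_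
  refine lt_of_le_of_lt (liminf_le_of_frequently_le' (x := ENNReal.ofReal (2 * lam * C)) ?_)
    ENNReal.ofReal_lt_top
  refine Frequently.of_forall fun n => ?_
  rw [← ofReal_integral_eq_lintegral_ofReal (integrable_two_mul_div_sq_add_sq_left hγ0 (hξn n)),
    ← hγrep _ (hξn n)]
  · refine ENNReal.ofReal_le_ofReal (mul_le_mul_of_nonneg_left (hC _ ?_) (by positivity))
    have := hξn n
    positivity
  · filter_upwards [hpos] with α hα
    simp only [Pi.zero_apply]
    positivity

/-- The kernel of a complete Bernstein exponent is a mixture of Cauchy kernels. -/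
theorem IsRegularExponent.exists_measure_thetaKernel {Ψ : ℝ → ℝ} {lam : ℝ}
    (h : IsRegularExponent Ψ) (hlam : 0 < lam)
    {ψ : ℝ → ℝ} (hψ : IsCompleteBernstein ψ) (hΨψ : ∀ ξ : ℝ, 0 < ξ → Ψ ξ = ψ (ξ ^ 2)) :
    (∃ C, ∀ ξ, |thetaKernel Ψ lam ξ| ≤ C) ∧ Integrable (thetaKernel Ψ lam) ∧
    ∃ γ : Measure ℝ, IsFiniteMeasure γ ∧ γ (Iic 0) = 0 ∧ Integrable (fun α => 2 / α) γ ∧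
      ∀ ξ, 0 < ξ → ξ ≠ lam → thetaKernel Ψ lam ξ = ∫ α, 2 * α / (α ^ 2 + ξ ^ 2) ∂γ := by
  obtain ⟨H, hH, hH0, hHC, hK⟩ := h.exists_stieltjes_thetaKernel hlam hψ hΨψ
  obtain ⟨hbdd, hint⟩ := h.exists_bound_thetaKernel hlam ⟨2 * lam * (lam ^ 2)⁻¹, by
    filter_upwards [lt_mem_nhds hlam] with ξ hξ
    by_cases hne : ξ = lam
    · rw [hne, thetaKernel_self, abs_zero]; positivity
    · have hb : 0 < ξ ^ 2 := by positivity
      have := hH0 _ hb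
      rw [hK ξ hξ hne, abs_of_nonneg (by positivity)]
      exact mul_le_mul_of_nonneg_left (hHC _ hb) (by positivity)⟩
  refine ⟨hbdd, hint, ?_⟩
  have hHint : Integrable fun ξ : ℝ => H (ξ ^ 2) := by
    refine (hint.const_mul (2 * lam)⁻¹).congr ?_
    have hnull : (volume : Measure ℝ) {0, lam, -lam} = 0 := Set.Finite.measure_zero (by simp) _
    filter_upwards [compl_mem_ae_iff.2 hnull] with ξ hξ
    simp only [mem_compl_iff, mem_insert_iff, mem_singleton_iff, not_or] at hξ
    rw [← h.thetaKernel_abs, hK |ξ| (abs_pos.2 hξ.1), sq_abs]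
    · field_simp
    · intro h0
      rcases abs_choice ξ with h1 | h1
      · exact hξ.2.1 (h1 ▸ h0)
      · exact hξ.2.2 (by linarith)
  obtain ⟨γ, hfin, hγ0, hinv, hrep⟩ := hH.exists_measure hlam hHC hHint
  exact ⟨γ, hfin, hγ0, hinv, fun ξ hξ hne => by rw [hK ξ hξ hne, hrep ξ hξ]⟩

/-! ### Two-sided Laplace transforms: Fourier transform and complete monotonicity -/

/-- The two-sided Laplace transform `x ↦ ∫ exp(-α|x|) γ(dα)`. -/
def laplaceAbs (γ : Measure ℝ) (x : ℝ) : ℝ := ∫ α, Real.exp (-(α * |x|)) ∂γ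

section

variable {α : ℝ}

theorem integrable_and_integral_exp_mul_exp_abs (hα : 0 < α) (ξ : ℝ) :
    Integrable (fun x : ℝ =>
      Complex.exp (Complex.I * (ξ : ℂ) * (x : ℂ)) * (Real.exp (-(α * |x|)) : ℂ)) ∧
    ∫ x : ℝ, Complex.exp (Complex.I * (ξ : ℂ) * (x : ℂ)) * (Real.exp (-(α * |x|)) : ℂ)
      = ((2 * α / (α ^ 2 + ξ ^ 2) : ℝ) : ℂ) := by
  have hre1 : (Complex.I * (ξ : ℂ) - (α : ℂ)).re < 0 := by simpa using hα
  have hre2 : 0 < (Complex.I * (ξ : ℂ) + (α : ℂ)).re := by simpa using hα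
  set F : ℝ → ℂ := fun x =>
    Complex.exp (Complex.I * (ξ : ℂ) * (x : ℂ)) * (Real.exp (-(α * |x|)) : ℂ) with hF
  have h1 : EqOn F (fun x : ℝ => Complex.exp ((Complex.I * (ξ : ℂ) - (α : ℂ)) * x)) (Ioi 0) := by
    intro x hx
    simp only [hF]
    rw [abs_of_pos hx, Complex.ofReal_exp, ← Complex.exp_add]
    congr 1; push_cast; ring
  have h2 : EqOn F (fun x : ℝ => Complex.exp ((Complex.I * (ξ : ℂ) + (α : ℂ)) * x)) (Iic 0) := by
    intro x hx
    simp only [hF]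
    rw [abs_of_nonpos hx, Complex.ofReal_exp, ← Complex.exp_add]
    congr 1; push_cast; ring
  have hi1 : IntegrableOn F (Ioi 0) :=
    (integrableOn_exp_mul_complex_Ioi hre1 0).congr_fun h1.symm measurableSet_Ioi
  have hi2 : IntegrableOn F (Iic 0) :=
    (integrableOn_exp_mul_complex_Iic hre2 0).congr_fun h2.symm measurableSet_Iic
  refine ⟨by rw [← integrableOn_univ, ← Iic_union_Ioi (a := (0 : ℝ))]; exact hi2.union hi1, ?_⟩
  rw [← intervalIntegral.integral_Iic_add_Ioi hi2 hi1, setIntegral_congr_fun measurableSet_Ioi h1,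
    setIntegral_congr_fun measurableSet_Iic h2, integral_exp_mul_complex_Ioi hre1,
    integral_exp_mul_complex_Iic hre2]
  have hz1 : Complex.I * (ξ : ℂ) - (α : ℂ) ≠ 0 := fun h => by rw [h] at hre1; simp at hre1
  have hz2 : Complex.I * (ξ : ℂ) + (α : ℂ) ≠ 0 := fun h => by rw [h] at hre2; simp at hre2
  have hz3 : (α : ℂ) ^ 2 + (ξ : ℂ) ^ 2 ≠ 0 := by
    have : α ^ 2 + ξ ^ 2 ≠ 0 := by positivity
    exact_mod_cast this
  push_cast
  simp only [mul_zero, Complex.exp_zero]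
  field_simp
  ring_nf
  rw [Complex.I_sq]
  ring

theorem integrable_exp_neg_mul_abs (hα : 0 < α) : Integrable fun x : ℝ => Real.exp (-(α * |x|)) := by
  have := (integrable_and_integral_exp_mul_exp_abs hα 0).1
  simp only [Complex.ofReal_zero, mul_zero, zero_mul, Complex.exp_zero, one_mul] at this
  exact this.re

theorem integral_exp_neg_mul_abs (hα : 0 < α) : ∫ x : ℝ, Real.exp (-(α * |x|)) = 2 / α := by
  have := (integrable_and_integral_exp_mul_exp_abs hα 0).2
  simp only [Complex.ofReal_zero, mul_zero, zero_mul, Complex.exp_zero, one_mul] at this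
  rw [integral_complex_ofReal, Complex.ofReal_inj] at this
  rw [this]
  field_simp
  ring

end

theorem ae_pos_of_measure_Iic {γ : Measure ℝ} (hγ : γ (Iic 0) = 0) : ∀ᵐ α ∂γ, 0 < α := by
  filter_upwards [compl_mem_ae_iff.2 hγ] with α hα
  simpa using hα

theorem laplaceAbs_nonneg {γ : Measure ℝ} (x : ℝ) : 0 ≤ laplaceAbs γ x :=
  integral_nonneg fun _ => (Real.exp_pos _).le

section

variable {γ : Measure ℝ} [IsFiniteMeasure γ]

theorem abs_exp_neg_mul_abs_le {α : ℝ} (hα : 0 < α) (x : ℝ) : |Real.exp (-(α * |x|))| ≤ 1 := by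
  rw [Real.abs_exp, Real.exp_le_one_iff, neg_nonpos]
  positivity

theorem continuous_laplaceAbs (hγ : γ (Iic 0) = 0) : Continuous (laplaceAbs γ) := by
  refine continuous_of_dominated (bound := fun _ => 1)
    (fun x => Measurable.aestronglyMeasurable (by fun_prop)) (fun x => ?_) (integrable_const _)
    (ae_of_all _ fun α => by fun_prop)
  filter_upwards [ae_pos_of_measure_Iic hγ] with α hα using abs_exp_neg_mul_abs_le hα x

/-- Since exp(-α|x|) has integral 2/α in x, integrability of 2/α is exactly what Tonelli asks for.
-/
theorem integrable_prod_exp_neg_mul_abs (hγ : γ (Iic 0) = 0)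
    (hinv : Integrable (fun α => 2 / α) γ) :
    Integrable (fun p : ℝ × ℝ => Real.exp (-(p.2 * |p.1|))) (volume.prod γ) := by
  refine (integrable_prod_iff' (Measurable.aestronglyMeasurable (by fun_prop))).2 ⟨?_, ?_⟩
  · filter_upwards [ae_pos_of_measure_Iic hγ] with α hα using integrable_exp_neg_mul_abs hα
  · refine hinv.congr ?_
    filter_upwards [ae_pos_of_measure_Iic hγ] with α hα
    simp only [Real.norm_eq_abs, Real.abs_exp]
    exact (integral_exp_neg_mul_abs hα).symm

theorem integrable_laplaceAbs (hγ : γ (Iic 0) = 0)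
    (hinv : Integrable (fun α => 2 / α) γ) : Integrable (laplaceAbs γ) :=
  (integrable_prod_exp_neg_mul_abs hγ hinv).integral_prod_left

theorem integral_exp_mul_laplaceAbs (hγ : γ (Iic 0) = 0)
    (hinv : Integrable (fun α => 2 / α) γ) (ξ : ℝ) :
    ∫ x : ℝ, Complex.exp (Complex.I * (ξ : ℂ) * (x : ℂ)) * (laplaceAbs γ x : ℂ)
      = ((∫ α, 2 * α / (α ^ 2 + ξ ^ 2) ∂γ : ℝ) : ℂ) := by
  have h1 : ∀ x : ℝ, Complex.exp (Complex.I * (ξ : ℂ) * (x : ℂ)) * (laplaceAbs γ x : ℂ)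
      = ∫ α : ℝ, Complex.exp (Complex.I * (ξ : ℂ) * (x : ℂ)) * (Real.exp (-(α * |x|)) : ℂ) ∂γ := by
    intro x
    rw [integral_const_mul, integral_complex_ofReal]; rfl
  simp only [h1]
  rw [integral_integral_swap, ← integral_complex_ofReal]
  · refine integral_congr_ae ?_
    filter_upwards [ae_pos_of_measure_Iic hγ] with α hα
    exact (integrable_and_integral_exp_mul_exp_abs hα ξ).2
  · refine (integrable_prod_exp_neg_mul_abs hγ hinv).mono
      (Measurable.aestronglyMeasurable (by fun_prop)) (ae_of_all _ fun p => ?_)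
    simp only [Function.uncurry]
    rw [norm_mul, Complex.norm_exp, Complex.norm_real]
    simp

/-- On (0, ∞) this is the moment generating function of γ at -x, analytic there because γ is carried
by (0, ∞). Each derivative in x brings down a factor -α. -/
theorem isCompletelyMonotoneOnIci_laplaceAbs (hγ : γ (Iic 0) = 0) :
    IsCompletelyMonotoneOnIci (laplaceAbs γ) := by
  have hset : ∀ x : ℝ, x < 0 → x ∈ interior (integrableExpSet id γ) := by
    intro x hx
    refine mem_interior.2 ⟨Iio 0, fun y hy => ?_, isOpen_Iio, hx⟩
    refine (integrable_const (1 : ℝ)).mono' (Measurable.aestronglyMeasurable (by fun_prop)) ?_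
    filter_upwards [ae_pos_of_measure_Iic hγ] with α hα
    rw [Real.norm_eq_abs, Real.abs_exp, Real.exp_le_one_iff, id]
    exact mul_nonpos_of_nonpos_of_nonneg (le_of_lt hy) hα.le
  have heq : EqOn (laplaceAbs γ) (fun x => mgf id γ (-x)) (Ioi 0) := by
    intro x hx
    refine integral_congr_ae (ae_of_all _ fun α => ?_)
    simp only [id]
    rw [abs_of_pos hx]
    congr 1
    ring
  refine ⟨(continuous_laplaceAbs hγ).continuousOn, ?_, fun n x hx => ?_⟩
  · refine ContDiffOn.congr (fun x hx => ?_) heq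
    have h1 := (analyticAt_mgf (hset (-x) (by simpa using hx))).contDiffAt
      (n := ((⊤ : ℕ∞) : WithTop ℕ∞))
    exact (h1.comp x contDiff_neg.contDiffAt).contDiffWithinAt
  · have h1 : iteratedDeriv n (laplaceAbs γ) x = iteratedDeriv n (fun x => mgf id γ (-x)) x := by
      refine Filter.EventuallyEq.iteratedDeriv_eq n ?_
      filter_upwards [Ioi_mem_nhds hx] with y hy using heq hy
    rw [h1, iteratedDeriv_comp_neg, iteratedDeriv_mgf (hset (-x) (by simpa using hx)), smul_eq_mul,
      ← mul_assoc, ← mul_pow]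
    simp only [mul_neg, mul_one, neg_neg, one_pow, one_mul, id]
    refine integral_nonneg_of_ae ?_
    filter_upwards [ae_pos_of_measure_Iic hγ] with α hα
    simp only [Pi.zero_apply]
    positivity

end

/-! ### Poisson kernels and Stieltjes inversion -/

/-- The Poisson kernel of the half-plane, normalized at height one. -/
def cauchyDensity (u : ℝ) : ℝ := Real.pi⁻¹ * (1 + u ^ 2)⁻¹

theorem cauchyDensity_pos (u : ℝ) : 0 < cauchyDensity u := by
  have := Real.pi_pos
  unfold cauchyDensity
  positivity

theorem continuous_cauchyDensity : Continuous cauchyDensity := by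
  unfold cauchyDensity
  refine continuous_const.mul (Continuous.inv₀ (by fun_prop) fun u => ?_)
  positivity

theorem integrable_cauchyDensity : Integrable cauchyDensity :=
  integrable_inv_one_add_sq.const_mul _

theorem integral_cauchyDensity : ∫ u, cauchyDensity u = 1 := by
  unfold cauchyDensity
  rw [integral_const_mul, integral_univ_inv_one_add_sq, inv_mul_cancel₀ Real.pi_ne_zero]

theorem cauchyDensity_le_one (u : ℝ) : cauchyDensity u ≤ 1 := by
  unfold cauchyDensity
  refine mul_le_one₀ ?_ (by positivity) (inv_le_one_of_one_le₀ (by nlinarith [sq_nonneg u]))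
  exact inv_le_one_of_one_le₀ (by linarith [Real.pi_gt_three])

/-- The difference of Poisson kernels at height `ε` centred at `α` and `-α`. -/
def oddPoisson (ε α η : ℝ) : ℝ :=
  ε⁻¹ * cauchyDensity ((η - α) / ε) - ε⁻¹ * cauchyDensity ((η + α) / ε)

/-- The bound comes from the imaginary part and is uniform in α, so on Re z > 0 the factors of α² +
z² have inverses integrable over any finite measure. -/
theorem re_le_norm_add_I_mul (α : ℝ) (z : ℂ) : z.re ≤ ‖(α : ℂ) + Complex.I * z‖ := by
  refine le_trans (le_abs_self _) (le_trans (le_of_eq ?_) (Complex.abs_im_le_norm _))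
  simp

theorem re_le_norm_sub_I_mul (α : ℝ) (z : ℂ) : z.re ≤ ‖(α : ℂ) - Complex.I * z‖ := by
  refine le_trans (le_abs_self _) (le_trans (le_of_eq ?_) (Complex.abs_im_le_norm _))
  simp

theorem add_I_mul_ne_zero (α : ℝ) {z : ℂ} (hz : 0 < z.re) : (α : ℂ) + Complex.I * z ≠ 0 :=
  norm_pos_iff.1 (hz.trans_le (re_le_norm_add_I_mul α z))

theorem sub_I_mul_ne_zero (α : ℝ) {z : ℂ} (hz : 0 < z.re) : (α : ℂ) - Complex.I * z ≠ 0 :=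
  norm_pos_iff.1 (hz.trans_le (re_le_norm_sub_I_mul α z))

theorem two_mul_div_sq_add_sq_eq_add (α : ℝ) {z : ℂ} (hz : 0 < z.re) :
    2 * (α : ℂ) / ((α : ℂ) ^ 2 + z ^ 2)
      = ((α : ℂ) + Complex.I * z)⁻¹ + ((α : ℂ) - Complex.I * z)⁻¹ := by
  have h1 := add_I_mul_ne_zero α hz
  have h2 := sub_I_mul_ne_zero α hz
  have h3 : (α : ℂ) ^ 2 + z ^ 2 = ((α : ℂ) + Complex.I * z) * ((α : ℂ) - Complex.I * z) := by
    ring_nf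
    rw [Complex.I_sq]
    ring
  rw [h3]
  field_simp
  ring

/-- This is the source of the inversion formula: on the line Re z = ε the imaginary part of a Cauchy
kernel is an approximate identity at ±α. -/
theorem neg_inv_pi_mul_im_eq_oddPoisson {ε : ℝ} (hε : 0 < ε) (α η : ℝ) :
    -(Real.pi⁻¹ * (2 * (α : ℂ) / ((α : ℂ) ^ 2 + ((ε : ℂ) + Complex.I * (η : ℂ)) ^ 2)).im)
      = oddPoisson ε α η := by
  rw [two_mul_div_sq_add_sq_eq_add α (by simpa using hε)]
  have h1 : (η - α) ^ 2 + ε ^ 2 ≠ 0 := by positivity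
  have h2 : (η + α) ^ 2 + ε ^ 2 ≠ 0 := by positivity
  have h3 : 1 + ((η - α) / ε) ^ 2 = ((η - α) ^ 2 + ε ^ 2) / ε ^ 2 := by field_simp; ring
  have h4 : 1 + ((η + α) / ε) ^ 2 = ((η + α) ^ 2 + ε ^ 2) / ε ^ 2 := by field_simp; ring
  have h5 : ((α : ℂ) + Complex.I * ((ε : ℂ) + Complex.I * (η : ℂ)))
      = ⟨α - η, ε⟩ := by
    apply Complex.ext <;> simp
    ring
  have h6 : ((α : ℂ) - Complex.I * ((ε : ℂ) + Complex.I * (η : ℂ)))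
      = ⟨α + η, -ε⟩ := by
    apply Complex.ext <;> simp
  rw [h5, h6, Complex.add_im, Complex.inv_im, Complex.inv_im, Complex.normSq_mk, Complex.normSq_mk]
  unfold oddPoisson cauchyDensity
  rw [h3, h4, show (α - η) * (α - η) + ε * ε = (η - α) ^ 2 + ε ^ 2 by ring,
    show (α + η) * (α + η) + -ε * -ε = (η + α) ^ 2 + ε ^ 2 by ring]
  field_simp
  ring

/-- A point η ≥ 0 is no farther from α than from -α. -/
theorem oddPoisson_nonneg {ε α η : ℝ} (hε : 0 < ε) (hα : 0 ≤ α) (hη : 0 ≤ η) :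
    0 ≤ oddPoisson ε α η := by
  unfold oddPoisson cauchyDensity
  have := Real.pi_pos
  rw [sub_nonneg]
  gcongr 3
  rw [div_pow, div_pow]
  gcongr 1 + ?_ / _
  nlinarith [mul_nonneg hα hη]

theorem abs_oddPoisson_le {ε : ℝ} (hε : 0 < ε) (α η : ℝ) : |oddPoisson ε α η| ≤ ε⁻¹ := by
  have h := inv_pos.2 hε
  have h1 := mul_le_of_le_one_right h.le (cauchyDensity_le_one ((η - α) / ε))
  have h2 := mul_le_of_le_one_right h.le (cauchyDensity_le_one ((η + α) / ε))
  have h3 := mul_pos h (cauchyDensity_pos ((η - α) / ε))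
  have h4 := mul_pos h (cauchyDensity_pos ((η + α) / ε))
  rw [oddPoisson, abs_le]
  constructor <;> linarith

theorem integral_mul_cauchyDensity {ε : ℝ} (hε : 0 < ε) (φ : ℝ → ℝ) (α : ℝ) :
    ∫ η, φ η * (ε⁻¹ * cauchyDensity ((η - α) / ε)) = ∫ u, φ (α + ε * u) * cauchyDensity u := by
  rw [← integral_add_left_eq_self _ α]
  have h := Measure.integral_comp_mul_left
    (fun y => φ (α + y) * (ε⁻¹ * cauchyDensity ((α + y - α) / ε))) ε
  rw [abs_of_pos (inv_pos.2 hε), smul_eq_mul, eq_inv_mul_iff_mul_eq₀ hε.ne',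
    ← integral_const_mul] at h
  rw [← h]
  refine integral_congr_ae (ae_of_all _ fun u => ?_)
  simp only [add_sub_cancel_left]
  rw [mul_div_cancel_left₀ _ hε.ne']
  field_simp

/-- Poisson kernels form an approximate identity on bounded continuous functions. -/
theorem tendsto_integral_mul_cauchyDensity {φ : ℝ → ℝ} (hφ : Continuous φ) {M : ℝ}
    (hM : ∀ η, |φ η| ≤ M) (α : ℝ) {ε : ℕ → ℝ} (hε : Tendsto ε atTop (𝓝 0)) :
    Tendsto (fun n => ∫ u, φ (α + ε n * u) * cauchyDensity u) atTop (𝓝 (φ α)) := by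
  have h1 : φ α = ∫ u, φ α * cauchyDensity u := by
    rw [integral_const_mul, integral_cauchyDensity, mul_one]
  rw [h1]
  have := continuous_cauchyDensity
  refine tendsto_integral_of_dominated_convergence (fun u => M * cauchyDensity u)
    (fun n => Continuous.aestronglyMeasurable (by fun_prop)) (integrable_cauchyDensity.const_mul _)
    (fun n => ae_of_all _ fun u => ?_) (ae_of_all _ fun u => ?_)
  · rw [norm_mul, Real.norm_of_nonneg (cauchyDensity_pos u).le]
    exact mul_le_mul_of_nonneg_right (hM _) (cauchyDensity_pos u).le
  · refine Tendsto.mul_const _ ((hφ.tendsto α).comp ?_)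
    simpa using (hε.mul_const u).const_add α

theorem abs_integral_mul_cauchyDensity_le {φ : ℝ → ℝ} {M : ℝ}
    (hM : ∀ η, |φ η| ≤ M) (α ε : ℝ) :
    |∫ u, φ (α + ε * u) * cauchyDensity u| ≤ M := by
  have h1 : M = ∫ u, M * cauchyDensity u := by
    rw [integral_const_mul, integral_cauchyDensity, mul_one]
  rw [h1, ← Real.norm_eq_abs]
  refine norm_integral_le_of_norm_le (integrable_cauchyDensity.const_mul _)
    (ae_of_all _ fun u => ?_)
  rw [norm_mul, Real.norm_of_nonneg (cauchyDensity_pos u).le]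
  exact mul_le_mul_of_nonneg_right (hM _) (cauchyDensity_pos u).le

section Inversion

variable {γ : Measure ℝ} [IsFiniteMeasure γ]

theorem integrable_inv_add_I_mul {z : ℂ} (hz : 0 < z.re) :
    Integrable (fun α : ℝ => ((α : ℂ) + Complex.I * z)⁻¹) γ := by
  refine (integrable_const (z.re)⁻¹).mono' (Measurable.aestronglyMeasurable (by fun_prop))
    (ae_of_all _ fun α => ?_)
  rw [norm_inv]
  exact inv_anti₀ hz (re_le_norm_add_I_mul α z)

theorem integrable_inv_sub_I_mul {z : ℂ} (hz : 0 < z.re) :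
    Integrable (fun α : ℝ => ((α : ℂ) - Complex.I * z)⁻¹) γ := by
  refine (integrable_const (z.re)⁻¹).mono' (Measurable.aestronglyMeasurable (by fun_prop))
    (ae_of_all _ fun α => ?_)
  rw [norm_inv]
  exact inv_anti₀ hz (re_le_norm_sub_I_mul α z)

theorem integrable_two_mul_div_sq_add_sq_complex {z : ℂ} (hz : 0 < z.re) :
    Integrable (fun α : ℝ => 2 * (α : ℂ) / ((α : ℂ) ^ 2 + z ^ 2)) γ := by
  simp only [two_mul_div_sq_add_sq_eq_add _ hz]
  exact (integrable_inv_add_I_mul hz).add (integrable_inv_sub_I_mul hz)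

/-- Differentiation under the integral on the half-plane Re w > Re z/2, where the derivative is
uniformly bounded. The constant c stands for ±i. -/
theorem differentiableAt_integral_inv {c : ℂ} (hc : ‖c‖ = 1)
    (hcz : ∀ (α : ℝ) (z : ℂ), z.re ≤ ‖(α : ℂ) + c * z‖) {z : ℂ} (hz : 0 < z.re) :
    DifferentiableAt ℂ (fun z => ∫ α : ℝ, ((α : ℂ) + c * z)⁻¹ ∂γ) z := by
  have hU : {w : ℂ | z.re / 2 < w.re} ∈ 𝓝 z :=
    (isOpen_lt continuous_const Complex.continuous_re).mem_nhds (half_lt_self hz)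
  have hne : ∀ (α : ℝ) (w : ℂ), 0 < w.re → (α : ℂ) + c * w ≠ 0 := fun α w hw =>
    norm_pos_iff.1 (hw.trans_le (hcz α w))
  refine (hasDerivAt_integral_of_dominated_loc_of_deriv_le (𝕜 := ℂ) (μ := γ)
    (F := fun (w : ℂ) (α : ℝ) => ((α : ℂ) + c * w)⁻¹)
    (F' := fun (w : ℂ) (α : ℝ) => -(c * 1) / ((α : ℂ) + c * w) ^ 2)
    (bound := fun _ => ((z.re / 2) ^ 2)⁻¹) hU
    (Eventually.of_forall fun w => Measurable.aestronglyMeasurable (by fun_prop)) ?_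
    (Measurable.aestronglyMeasurable (by fun_prop)) (ae_of_all _ fun α w hw => ?_)
    (integrable_const _) (ae_of_all _ fun α w hw => ?_)).2.differentiableAt
  · refine (integrable_const (z.re)⁻¹).mono' (Measurable.aestronglyMeasurable (by fun_prop))
      (ae_of_all _ fun α => ?_)
    rw [norm_inv]
    exact inv_anti₀ hz (hcz α z)
  · have hw' : z.re / 2 < w.re := hw
    rw [norm_div, norm_neg, norm_mul, hc, norm_one, norm_pow, mul_one, one_div]
    refine inv_anti₀ (by positivity) ?_
    exact pow_le_pow_left₀ (by positivity) (hw'.le.trans (hcz α w)) 2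
  · have hw' : z.re / 2 < w.re := hw
    exact (((hasDerivAt_id w).const_mul c).const_add (α : ℂ)).inv (hne α w (by linarith))

theorem differentiableOn_integral_two_mul_div :
    DifferentiableOn ℂ (fun z => ∫ α : ℝ, 2 * (α : ℂ) / ((α : ℂ) ^ 2 + z ^ 2) ∂γ)
      {z : ℂ | 0 < z.re} := by
  have h1 : ∀ z ∈ {z : ℂ | 0 < z.re}, ∫ α : ℝ, 2 * (α : ℂ) / ((α : ℂ) ^ 2 + z ^ 2) ∂γ
      = (∫ α : ℝ, ((α : ℂ) + Complex.I * z)⁻¹ ∂γ)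
        + ∫ α : ℝ, ((α : ℂ) + (-Complex.I) * z)⁻¹ ∂γ := by
    intro z hz
    have h2 := integrable_inv_sub_I_mul (γ := γ) hz
    simp only [sub_eq_add_neg, ← neg_mul] at h2
    rw [← integral_add (integrable_inv_add_I_mul hz) h2]
    refine integral_congr_ae (ae_of_all _ fun α => ?_)
    simp only [two_mul_div_sq_add_sq_eq_add α hz, sub_eq_add_neg, neg_mul]
  refine DifferentiableOn.congr (fun z hz => ?_) h1
  refine (DifferentiableAt.add (differentiableAt_integral_inv (by simp) re_le_norm_add_I_mul hz)
    (differentiableAt_integral_inv (by simp) (fun α z => ?_) hz)).differentiableWithinAt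
  have := re_le_norm_sub_I_mul α z
  rwa [sub_eq_add_neg, ← neg_mul] at this

theorem im_integral_two_mul_div {ε : ℝ} (hε : 0 < ε) (η : ℝ) :
    -(Real.pi⁻¹ *
      (∫ α : ℝ, 2 * (α : ℂ) / ((α : ℂ) ^ 2 + ((ε : ℂ) + Complex.I * (η : ℂ)) ^ 2) ∂γ).im)
      = ∫ α, oddPoisson ε α η ∂γ := by
  have hz : 0 < ((ε : ℂ) + Complex.I * (η : ℂ)).re := by simpa using hε
  have h1 := Complex.imCLM.integral_comp_comm (integrable_two_mul_div_sq_add_sq_complex (γ := γ) hz)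
  simp only [Complex.imCLM_apply] at h1
  rw [← h1, ← integral_const_mul, ← integral_neg]
  exact integral_congr_ae (ae_of_all _ fun α => neg_inv_pi_mul_im_eq_oddPoisson hε α η)

variable {K : ℂ → ℂ}

theorem tendsto_im_boundary (hKc : ContinuousOn K {z : ℂ | 0 ≤ z.re ∧ 0 < z.im}) {η : ℝ}
    (hη : 0 < η) {ε : ℕ → ℝ} (hε0 : ∀ n, 0 < ε n) (hε : Tendsto ε atTop (𝓝 0)) :
    Tendsto (fun n => -(Real.pi⁻¹ * (K ((ε n : ℂ) + Complex.I * (η : ℂ))).im)) atTop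
      (𝓝 (-(Real.pi⁻¹ * (K (Complex.I * (η : ℂ))).im))) := by
  refine (Tendsto.const_mul _ ((Complex.continuous_im.tendsto _).comp ?_)).neg
  refine (hKc (Complex.I * (η : ℂ)) (by simpa using hη)).tendsto.comp
    (tendsto_nhdsWithin_iff.2 ⟨?_, Eventually.of_forall fun n => ?_⟩)
  · have h1 : Tendsto (fun n => (ε n : ℂ)) atTop (𝓝 ((0 : ℝ) : ℂ)) :=
      (Complex.continuous_ofReal.tendsto 0).comp hε
    simpa using h1.add_const (Complex.I * (η : ℂ))
  · simpa using ⟨(hε0 n).le, hη⟩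

theorem boundary_density_nonneg (hγ : γ (Iic 0) = 0)
    (hKc : ContinuousOn K {z : ℂ | 0 ≤ z.re ∧ 0 < z.im})
    (hK : ∀ z : ℂ, 0 < z.re → 0 < z.im →
      K z = ∫ α : ℝ, 2 * (α : ℂ) / ((α : ℂ) ^ 2 + z ^ 2) ∂γ) {η : ℝ} (hη : 0 < η) :
    0 ≤ -(Real.pi⁻¹ * (K (Complex.I * (η : ℂ))).im) := by
  set ε : ℕ → ℝ := fun n => 1 / ((n : ℝ) + 1) with hε
  have hε0 : ∀ n : ℕ, 0 < ε n := fun n => by positivity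
  refine ge_of_tendsto' (tendsto_im_boundary hKc hη hε0 tendsto_one_div_add_atTop_nhds_zero_nat)
    fun n => ?_
  rw [hK _ (by simpa using hε0 n) (by simpa using hη), im_integral_two_mul_div (hε0 n)]
  refine integral_nonneg_of_ae ?_
  filter_upwards [ae_pos_of_measure_Iic hγ] with α hα using oddPoisson_nonneg (hε0 n) hα.le hη.le

/-- Stieltjes inversion against test functions supported in `(0, ∞)`. -/
theorem integral_eq_integral_boundary (hγ : γ (Iic 0) = 0)
    (hKc : ContinuousOn K {z : ℂ | 0 ≤ z.re ∧ 0 < z.im})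
    (hK : ∀ z : ℂ, 0 < z.re → 0 < z.im →
      K z = ∫ α : ℝ, 2 * (α : ℂ) / ((α : ℂ) ^ 2 + z ^ 2) ∂γ)
    {φ : ℝ → ℝ} (hφ : Continuous φ) {A B : ℝ} (hA : 0 < A) (hsupp : ∀ η, η ∉ Icc A B → φ η = 0) :
    IntegrableOn (fun η => φ η * -(Real.pi⁻¹ * (K (Complex.I * (η : ℂ))).im)) (Ioi 0) ∧
    ∫ α, φ α ∂γ = ∫ η in Ioi 0, φ η * -(Real.pi⁻¹ * (K (Complex.I * (η : ℂ))).im) := by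
  have hcs : HasCompactSupport φ := HasCompactSupport.intro isCompact_Icc hsupp
  obtain ⟨M, hM⟩ := hφ.bounded_above_of_compact_support hcs
  have hφint : Integrable φ := hφ.integrable_of_hasCompactSupport hcs
  have hφneg : ∀ η, η ≤ 0 → φ η = 0 := fun η hη => hsupp η fun h => by linarith [h.1]
  set ε : ℕ → ℝ := fun n => 1 / ((n : ℝ) + 1) with hεdef
  have hε0 : ∀ n, 0 < ε n := fun n => by positivity
  have hε1 : ∀ n, ε n ≤ 1 := fun n => by
    rw [hεdef]; exact (div_le_one (by positivity)).2 (by linarith [(Nat.cast_nonneg n : (0 : ℝ) ≤ n)])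
  have hε : Tendsto ε atTop (𝓝 0) := tendsto_one_div_add_atTop_nhds_zero_nat
  have hIcc : ∀ f : ℝ → ℝ, ∫ η in Ioi 0, φ η * f η = ∫ η in Icc A B, φ η * f η := by
    intro f
    refine setIntegral_eq_of_subset_of_forall_sdiff_eq_zero measurableSet_Ioi
      (fun η hη => hA.trans_le hη.1) fun η hη => ?_
    rw [hsupp η hη.2, zero_mul]
  -- The support of φ stays away from 0, so K is continuous, hence bounded, on the compact rectangle
  -- [0, 1] + i[A, B].
  obtain ⟨D, hD⟩ : ∃ D, ∀ x ∈ Icc (0 : ℝ) 1, ∀ η ∈ Icc A B,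
      |-(Real.pi⁻¹ * (K ((x : ℂ) + Complex.I * (η : ℂ))).im)| ≤ D := by
    have hcont : ContinuousOn
        (fun p : ℝ × ℝ => -(Real.pi⁻¹ * (K ((p.1 : ℂ) + Complex.I * (p.2 : ℂ))).im))
        (Icc 0 1 ×ˢ Icc A B) := by
      refine (continuousOn_const.mul (Complex.continuous_im.comp_continuousOn
        (hKc.comp (by fun_prop) fun p hp => ?_))).neg
      have h1 := hp.1.1
      have h2 := hA.trans_le hp.2.1
      simpa using ⟨h1, h2⟩
    obtain ⟨D, hD⟩ := (isCompact_Icc.prod isCompact_Icc).exists_bound_of_continuousOn hcont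
    exact ⟨D, fun x hx η hη => hD (x, η) ⟨hx, hη⟩⟩
  have hcontv : ∀ x ∈ Icc (0 : ℝ) 1, ContinuousOn
      (fun η : ℝ => φ η * -(Real.pi⁻¹ * (K ((x : ℂ) + Complex.I * (η : ℂ))).im)) (Icc A B) := by
    intro x hx
    refine hφ.continuousOn.mul (continuousOn_const.mul (Complex.continuous_im.comp_continuousOn
        (hKc.comp (by fun_prop) fun η hη => ?_))).neg
    have h1 := hx.1
    have h2 := hA.trans_le hη.1
    simpa using ⟨h1, h2⟩
  have hcontv0 : ContinuousOn
      (fun η : ℝ => φ η * -(Real.pi⁻¹ * (K (Complex.I * (η : ℂ))).im)) (Icc A B) := by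
    simpa using hcontv 0 ⟨le_rfl, zero_le_one⟩
  refine ⟨?_, ?_⟩
  · refine IntegrableOn.of_forall_sdiff_eq_zero (s := Icc A B)
      (hcontv0.integrableOn_Icc) measurableSet_Ioi fun η hη => ?_
    rw [hsupp η hη.2, zero_mul]
  have hlim1 : Tendsto
      (fun n => ∫ η in Ioi 0, φ η * -(Real.pi⁻¹ * (K ((ε n : ℂ) + Complex.I * (η : ℂ))).im)) atTop
      (𝓝 (∫ η in Ioi 0, φ η * -(Real.pi⁻¹ * (K (Complex.I * (η : ℂ))).im))) := by
    simp only [hIcc]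
    refine tendsto_integral_of_dominated_convergence (fun _ => M * D) (fun n => ?_)
      (integrable_const _) (fun n => ?_) ?_
    · exact (hcontv _ ⟨(hε0 n).le, hε1 n⟩).aestronglyMeasurable measurableSet_Icc
    · filter_upwards [ae_restrict_mem measurableSet_Icc] with η hη
      rw [norm_mul]
      exact mul_le_mul (hM η) (hD _ ⟨(hε0 n).le, hε1 n⟩ η hη) (abs_nonneg _)
        ((norm_nonneg _).trans (hM η))
    · filter_upwards [ae_restrict_mem measurableSet_Icc] with η hη
      exact (tendsto_im_boundary hKc (hA.trans_le hη.1) hε0 hε).const_mul _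
  -- Fubini turns the integral along Re z = ε into a γ-average of the Poisson smoothing of φ at α
  -- minus that at -α.
  have hfub : ∀ n, ∫ η in Ioi 0, φ η * -(Real.pi⁻¹ * (K ((ε n : ℂ) + Complex.I * (η : ℂ))).im)
      = ∫ α, ((∫ u, φ (α + ε n * u) * cauchyDensity u)
          - ∫ u, φ (-α + ε n * u) * cauchyDensity u) ∂γ := by
    intro n
    have h1 : ∫ η in Ioi 0, φ η * -(Real.pi⁻¹ * (K ((ε n : ℂ) + Complex.I * (η : ℂ))).im)
        = ∫ η, ∫ α, φ η * oddPoisson (ε n) α η ∂γ := by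
      refine Eq.trans (setIntegral_congr_fun measurableSet_Ioi fun η hη => ?_)
        (setIntegral_eq_integral_of_forall_compl_eq_zero (s := Ioi (0 : ℝ)) fun η hη => ?_)
      · have hη' : 0 < η := hη
        rw [hK _ (by simpa using hε0 n) (by simpa using hη'), im_integral_two_mul_div (hε0 n),
          integral_const_mul]
      · simp [hφneg η (by simpa using hη)]
    have hPc : Continuous fun p : ℝ × ℝ => oddPoisson (ε n) p.2 p.1 := by
      have := continuous_cauchyDensity
      unfold oddPoisson
      fun_prop
    rw [h1, integral_integral_swap]
    · refine integral_congr_ae (ae_of_all _ fun α => ?_)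
      have hi : ∀ x : ℝ, Integrable fun η => φ η * ((ε n)⁻¹ * cauchyDensity ((η - x) / ε n)) := by
        intro x
        have := continuous_cauchyDensity
        exact (Continuous.integrable_of_hasCompactSupport (by fun_prop) hcs.mul_right)
      have h2 := hi (-α)
      simp only [sub_neg_eq_add] at h2
      have h3 := integral_mul_cauchyDensity (hε0 n) φ (-α)
      simp only [sub_neg_eq_add] at h3
      simp only [oddPoisson, mul_sub]
      rw [integral_sub (hi α) h2, integral_mul_cauchyDensity (hε0 n), h3]
    · have h4 : Integrable (fun p : ℝ × ℝ => φ p.1 * (ε n)⁻¹) (volume.prod γ) :=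
        hφint.mul_prod (integrable_const (ε n)⁻¹)
      refine h4.mono (Continuous.aestronglyMeasurable (by unfold Function.uncurry; fun_prop))
        (ae_of_all _ fun p => ?_)
      simp only [Function.uncurry, norm_mul]
      refine mul_le_mul_of_nonneg_left ?_ (norm_nonneg _)
      rw [Real.norm_of_nonneg (inv_pos.2 (hε0 n)).le]
      exact abs_oddPoisson_le (hε0 n) _ _
  have hM' : ∀ η, |φ η| ≤ M := hM
  -- The smoothed values tend to φ(α) - φ(-α), and φ(-α) = 0 for α > 0.
  have hlim2 : Tendsto (fun n => ∫ α, ((∫ u, φ (α + ε n * u) * cauchyDensity u)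
          - ∫ u, φ (-α + ε n * u) * cauchyDensity u) ∂γ) atTop (𝓝 (∫ α, φ α ∂γ)) := by
    have := continuous_cauchyDensity
    have hcontI : ∀ (x : ℝ), Continuous fun α : ℝ => ∫ u, φ (α + x * u) * cauchyDensity u := by
      intro x
      refine continuous_of_dominated (bound := fun u => M * cauchyDensity u)
        (fun α => Continuous.aestronglyMeasurable (by fun_prop)) (fun α => ae_of_all _ fun u => ?_)
        (integrable_cauchyDensity.const_mul _) (ae_of_all _ fun u => by fun_prop)
      rw [norm_mul, Real.norm_of_nonneg (cauchyDensity_pos u).le]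
      exact mul_le_mul_of_nonneg_right (hM _) (cauchyDensity_pos u).le
    refine tendsto_integral_of_dominated_convergence (fun _ => M + M) (fun n => ?_)
      (integrable_const _) (fun n => ae_of_all _ fun α => ?_) ?_
    · exact ((hcontI (ε n)).sub ((hcontI (ε n)).comp continuous_neg)).aestronglyMeasurable
    · exact (abs_sub _ _).trans (add_le_add (abs_integral_mul_cauchyDensity_le hM' _ _)
        (abs_integral_mul_cauchyDensity_le hM' _ _))
    · filter_upwards [ae_pos_of_measure_Iic hγ] with α hα
      have h5 := (tendsto_integral_mul_cauchyDensity hφ hM' α hε).sub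
        (tendsto_integral_mul_cauchyDensity hφ hM' (-α) hε)
      rwa [hφneg (-α) (by linarith), sub_zero] at h5
  simp only [hfub] at hlim1
  exact tendsto_nhds_unique hlim2 hlim1

/-- Stieltjes inversion for the Laplace transform. -/
theorem laplaceAbs_eq_integral_boundary (hγ : γ (Iic 0) = 0)
    (hKc : ContinuousOn K {z : ℂ | 0 ≤ z.re ∧ 0 < z.im})
    (hK : ∀ z : ℂ, 0 < z.re → 0 < z.im →
      K z = ∫ α : ℝ, 2 * (α : ℂ) / ((α : ℂ) ^ 2 + z ^ 2) ∂γ) (x : ℝ) :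
    IntegrableOn (fun η : ℝ => -(Real.pi⁻¹ * (K (Complex.I * (η : ℂ))).im) * Real.exp (-(η * |x|)))
      (Ioi 0) ∧
    laplaceAbs γ x
      = ∫ η in Ioi (0 : ℝ), -(Real.pi⁻¹ * (K (Complex.I * (η : ℂ))).im) * Real.exp (-(η * |x|)) := by
  set v : ℝ → ℝ := fun η => -(Real.pi⁻¹ * (K (Complex.I * (η : ℂ))).im) with hv
  have hv0 : ∀ η, 0 < η → 0 ≤ v η := fun η hη => boundary_density_nonneg hγ hKc hK hη
  have hvc : ContinuousOn v (Ioi 0) := by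
    refine (continuousOn_const.mul (Complex.continuous_im.comp_continuousOn
        (hKc.comp (by fun_prop) fun η hη => ?_))).neg
    have h2 : 0 < η := hη
    simpa using h2
  -- Trapezoidal cutoffs, equal to 1 on [2/(n + 1), n + 1] once n ≥ 1 and to 0 outside [1/(n + 1), n
  -- + 2].
  set χ : ℕ → ℝ → ℝ := fun n η =>
    max 0 (min 1 (min (((n : ℝ) + 1) * η - 1) ((n : ℝ) + 2 - η))) with hχ
  have hχ0 : ∀ n η, 0 ≤ χ n η := fun n η => le_max_left _ _
  have hχ1 : ∀ n η, χ n η ≤ 1 := fun n η => max_le zero_le_one (min_le_left _ _)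
  have hχc : ∀ n, Continuous (χ n) := fun n => by fun_prop
  have hχs : ∀ (n : ℕ) (η : ℝ), η ∉ Icc (1 / ((n : ℝ) + 1)) ((n : ℝ) + 2) → χ n η = 0 := by
    intro n η hη
    refine max_eq_left ((min_le_right _ _).trans ?_)
    rw [mem_Icc, not_and_or, not_le, not_le, lt_div_iff₀ (by positivity)] at hη
    rcases hη with hη | hη
    · exact (min_le_left _ _).trans (by linarith)
    · exact (min_le_right _ _).trans (by linarith)
  have hχlim : ∀ η, 0 < η → Tendsto (fun n => χ n η) atTop (𝓝 1) := by
    intro η hη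
    refine tendsto_const_nhds.congr' ?_
    obtain ⟨N, hN⟩ := exists_nat_ge (max (2 / η) η)
    filter_upwards [eventually_ge_atTop N] with n hn
    have hn' : (N : ℝ) ≤ n := by exact_mod_cast hn
    have h1 : 2 / η ≤ n := ((le_max_left _ _).trans hN).trans hn'
    have h2 : η ≤ n := ((le_max_right _ _).trans hN).trans hn'
    rw [div_le_iff₀ hη] at h1
    simp only [hχ]
    rw [min_eq_left (le_min (by linarith) (by linarith)), max_eq_right zero_le_one]
  set e : ℝ → ℝ := fun η => Real.exp (-(η * |x|)) with he
  have he0 : ∀ η, 0 ≤ e η := fun η => (Real.exp_pos _).le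
  have hec : Continuous e := by fun_prop
  have htest : ∀ n, IntegrableOn (fun η => χ n η * e η * v η) (Ioi 0) ∧
      ∫ α, χ n α * e α ∂γ = ∫ η in Ioi 0, χ n η * e η * v η := fun n =>
    integral_eq_integral_boundary hγ hKc hK ((hχc n).mul hec)
      (A := 1 / ((n : ℝ) + 1)) (B := (n : ℝ) + 2) (by positivity) fun η hη => by
        simp only [hχs n η hη, zero_mul]
  have heint : Integrable e γ := by
    refine (integrable_const (1 : ℝ)).mono' hec.aestronglyMeasurable ?_
    filter_upwards [ae_pos_of_measure_Iic hγ] with α hα using abs_exp_neg_mul_abs_le hα x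
  have hlimγ : Tendsto (fun n => ∫ α, χ n α * e α ∂γ) atTop (𝓝 (laplaceAbs γ x)) := by
    refine tendsto_integral_of_dominated_convergence e
      (fun n => ((hχc n).mul hec).aestronglyMeasurable) heint (fun n => ae_of_all _ fun α => ?_) ?_
    · rw [Real.norm_of_nonneg (mul_nonneg (hχ0 n α) (he0 α))]
      exact mul_le_of_le_one_left (he0 α) (hχ1 n α)
    · filter_upwards [ae_pos_of_measure_Iic hγ] with α hα
      simpa using (hχlim α hα).mul_const (e α)
  have hmeas : AEStronglyMeasurable (fun η => v η * e η) (volume.restrict (Ioi 0)) :=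
    (hvc.mul hec.continuousOn).aestronglyMeasurable measurableSet_Ioi
  -- Since v ≥ 0, Fatou applies: the truncated integrals equal ∫ χₙ e dγ and are bounded by ∫ e dγ.
  have hint : IntegrableOn (fun η => v η * e η) (Ioi 0) := by
    refine ⟨hmeas, ?_⟩
    rw [hasFiniteIntegral_iff_ofReal (by
      filter_upwards [ae_restrict_mem measurableSet_Ioi] with η hη
      exact mul_nonneg (hv0 η hη) (he0 η))]
    have h1 : ∫⁻ η in Ioi 0, ENNReal.ofReal (v η * e η)
        = ∫⁻ η in Ioi 0, liminf (fun n => ENNReal.ofReal (χ n η * e η * v η)) atTop := by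
      refine setLIntegral_congr_fun measurableSet_Ioi fun η hη => ?_
      refine (Tendsto.liminf_eq (ENNReal.tendsto_ofReal ?_)).symm
      have := ((hχlim η hη).mul_const (e η)).mul_const (v η)
      simpa [mul_comm] using this
    rw [h1]
    refine (lintegral_liminf_le' fun n => (htest n).1.aemeasurable.ennreal_ofReal).trans_lt ?_
    refine lt_of_le_of_lt (liminf_le_of_frequently_le' (x := ENNReal.ofReal (∫ α, e α ∂γ)) ?_)
      ENNReal.ofReal_lt_top
    refine Frequently.of_forall fun n => ?_
    rw [← ofReal_integral_eq_lintegral_ofReal (htest n).1, ← (htest n).2]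
    · refine ENNReal.ofReal_le_ofReal (integral_mono ?_ heint fun α =>
        mul_le_of_le_one_left (he0 α) (hχ1 n α))
      refine heint.mono' ((hχc n).mul hec).aestronglyMeasurable (ae_of_all _ fun α => ?_)
      rw [Real.norm_of_nonneg (mul_nonneg (hχ0 n α) (he0 α))]
      exact mul_le_of_le_one_left (he0 α) (hχ1 n α)
    · filter_upwards [ae_restrict_mem measurableSet_Ioi] with η hη
      exact mul_nonneg (mul_nonneg (hχ0 n η) (he0 η)) (hv0 η hη)
  refine ⟨hint, ?_⟩
  have hlimv : Tendsto (fun n => ∫ η in Ioi 0, χ n η * e η * v η) atTop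
      (𝓝 (∫ η in Ioi 0, v η * e η)) := by
    refine tendsto_integral_of_dominated_convergence (fun η => v η * e η)
      (fun n => (htest n).1.aestronglyMeasurable) hint (fun n => ?_) ?_
    · filter_upwards [ae_restrict_mem measurableSet_Ioi] with η hη
      rw [Real.norm_of_nonneg (mul_nonneg (mul_nonneg (hχ0 n η) (he0 η)) (hv0 η hη)), mul_comm (v η)]
      exact mul_le_mul_of_nonneg_right (mul_le_of_le_one_left (he0 η) (hχ1 n η)) (hv0 η hη)
    · filter_upwards [ae_restrict_mem measurableSet_Ioi] with η hη
      have := ((hχlim η hη).mul_const (e η)).mul_const (v η)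
      simpa [mul_comm] using this
  simp only [(htest _).2] at hlimγ
  exact tendsto_nhds_unique hlimγ hlimv

end Inversion

/-! ### The eigenfunction as a Laplace transform and its explicit density -/

theorem cos_theta_pos (Ψ : ℝ → ℝ) (lam : ℝ) : 0 < Real.cos (theta Ψ lam) :=
  Real.cos_arctan_pos _

namespace IsRegularExponent

variable {Ψ : ℝ → ℝ} {lam : ℝ}

theorem theta_mem_Ico (hnonneg : ∀ ξ, 0 < ξ → 0 ≤ thetaKernel Ψ lam ξ) :
    theta Ψ lam ∈ Ico 0 (Real.pi / 2) := by
  refine ⟨Real.arctan_nonneg.2 (mul_nonneg (by have := Real.pi_pos; positivity) ?_),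
    Real.arctan_lt_pi_div_two _⟩
  exact setIntegral_nonneg measurableSet_Ioi hnonneg

theorem isL2C0WithFourier_eigenG (h : IsRegularExponent Ψ)
    (hbdd : ∃ C, ∀ ξ, |thetaKernel Ψ lam ξ| ≤ C) (hint : Integrable (thetaKernel Ψ lam)) :
    IsL2C0WithFourier (eigenG Ψ lam) (fourierG Ψ lam) := by
  obtain ⟨C, hC⟩ := hbdd
  have hL2 : MemLp (thetaKernel Ψ lam) 2 volume := by
    refine (memLp_two_iff_integrable_sq hint.1).2 ?_
    refine (hint.norm.const_mul C).mono' (hint.1.pow 2) (ae_of_all _ fun ξ => ?_)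
    rw [norm_pow, sq, Real.norm_eq_abs]
    exact mul_le_mul_of_nonneg_right (hC ξ) (abs_nonneg _)
  exact isL2C0WithFourier_invFourierRe h.fourierG_neg (hint.const_mul _) (hL2.const_mul _)

theorem eigenG_zero (h : IsRegularExponent Ψ) :
    eigenG Ψ lam 0 = Real.sin (theta Ψ lam) := by
  have h1 : ∫ ξ, thetaKernel Ψ lam ξ = 2 * ∫ ξ in Ioi 0, thetaKernel Ψ lam ξ := by
    rw [← integral_comp_abs]
    simp only [h.thetaKernel_abs]
  have h2 : Real.tan (theta Ψ lam) = (1 / Real.pi) * ∫ ξ in Ioi 0, thetaKernel Ψ lam ξ :=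
    Real.tan_arctan _
  rw [eigenG_eq_invFourierRe, invFourierRe_zero]
  simp only [fourierG]
  rw [integral_const_mul, h1, ← Real.tan_mul_cos (cos_theta_pos Ψ lam).ne', h2]
  have := Real.pi_ne_zero
  field_simp

variable {γ : Measure ℝ} [IsFiniteMeasure γ]

theorem eigenG_eq_laplaceAbs (h : IsRegularExponent Ψ) (hint : Integrable (thetaKernel Ψ lam))
    (hγ : γ (Iic 0) = 0) (hinv : Integrable (fun α => 2 / α) γ)
    (hrep : ∀ ξ, 0 < ξ → ξ ≠ lam → fourierG Ψ lam ξ = ∫ α, 2 * α / (α ^ 2 + ξ ^ 2) ∂γ) :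
    eigenG Ψ lam = laplaceAbs γ := by
  rw [eigenG_eq_invFourierRe]
  refine invFourierRe_eq_of_fourier (continuous_laplaceAbs hγ) (integrable_laplaceAbs hγ hinv)
    (hint.const_mul _) h.fourierG_neg ?_
  have hnull : (volume : Measure ℝ) {0, lam, -lam} = 0 := Set.Finite.measure_zero (by simp) _
  filter_upwards [compl_mem_ae_iff.2 hnull] with ξ hξ
  simp only [mem_compl_iff, mem_insert_iff, mem_singleton_iff, not_or] at hξ
  rw [integral_exp_mul_laplaceAbs hγ hinv, Complex.ofReal_inj]
  have h1 : fourierG Ψ lam ξ = fourierG Ψ lam |ξ| := by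
    simp only [fourierG, h.thetaKernel_abs]
  rw [h1, hrep |ξ| (abs_pos.2 hξ.1), sq_abs]
  intro h0
  rcases abs_choice ξ with h1 | h1
  · exact hξ.2.1 (h1 ▸ h0)
  · exact hξ.2.2 (by linarith)

/-- The mixture formula is available only for ξ > 0, so ξ = 0 is reached as a limit: by domination
by 2/α on one side and by continuity of the kernel at 0 on the other. -/
theorem integral_laplaceAbs_eq_fourierG_zero (h : IsRegularExponent Ψ) (hlam : 0 < lam)
    (hγ : γ (Iic 0) = 0) (hinv : Integrable (fun α => 2 / α) γ)
    (hrep : ∀ ξ, 0 < ξ → ξ ≠ lam → fourierG Ψ lam ξ = ∫ α, 2 * α / (α ^ 2 + ξ ^ 2) ∂γ) :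
    ∫ x, laplaceAbs γ x = fourierG Ψ lam 0 := by
  have h1 : ∫ x, laplaceAbs γ x = ∫ α, 2 * α / (α ^ 2 + 0 ^ 2) ∂γ := by
    have h2 := integral_exp_mul_laplaceAbs hγ hinv 0
    simp only [Complex.ofReal_zero, mul_zero, zero_mul, Complex.exp_zero, one_mul] at h2
    rwa [integral_complex_ofReal, Complex.ofReal_inj] at h2
  rw [h1]
  have h3 : Tendsto (fun ξ => ∫ α, 2 * α / (α ^ 2 + ξ ^ 2) ∂γ) (𝓝[>] 0)
      (𝓝 (∫ α, 2 * α / (α ^ 2 + 0 ^ 2) ∂γ)) := by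
    refine tendsto_integral_filter_of_dominated_convergence (fun α => 2 / α)
      (Eventually.of_forall fun ξ => Measurable.aestronglyMeasurable (by fun_prop))
      (Eventually.of_forall fun ξ => ?_) hinv ?_
    · filter_upwards [ae_pos_of_measure_Iic hγ] with α hα
      rw [Real.norm_of_nonneg (by positivity), div_le_div_iff₀ (by positivity) hα]
      nlinarith [sq_nonneg ξ]
    · filter_upwards [ae_pos_of_measure_Iic hγ] with α hα
      have h4 : α ^ 2 + 0 ^ 2 ≠ 0 := by positivity
      exact (ContinuousAt.tendsto (by fun_prop (disch := assumption) :
        ContinuousAt (fun ξ => 2 * α / (α ^ 2 + ξ ^ 2)) 0)).mono_left nhdsWithin_le_nhds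
  have h5 : Tendsto (fourierG Ψ lam) (𝓝[>] 0) (𝓝 (fourierG Ψ lam 0)) :=
    ((h.continuousAt_thetaKernel hlam le_rfl hlam.ne).tendsto.const_mul _).mono_left
      nhdsWithin_le_nhds
  refine tendsto_nhds_unique h3 (h5.congr' ?_)
  filter_upwards [Ioo_mem_nhdsGT hlam] with ξ hξ using hrep ξ hξ.1 hξ.2.ne

/-- The mixture representation of the kernel persists for a holomorphic extension of `Ψ`. -/
theorem extension_kernel_eq (h : IsRegularExponent Ψ) (hlam : 0 < lam)
    (hrep : ∀ ξ, 0 < ξ → ξ ≠ lam → thetaKernel Ψ lam ξ = ∫ α, 2 * α / (α ^ 2 + ξ ^ 2) ∂γ)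
    {Ψp : ℂ → ℂ} (hd : DifferentiableOn ℂ Ψp {z : ℂ | 0 < z.re})
    (hext : ∀ ξ : ℝ, 0 < ξ → Ψp (ξ : ℂ) = (Ψ ξ : ℂ)) {z : ℂ} (hz : 0 < z.re) (hz' : z.im ≠ 0) :
    (Ψ lam : ℂ) - Ψp z ≠ 0 ∧
    2 * (lam : ℂ) / ((lam : ℂ) ^ 2 - z ^ 2) - ((deriv Ψ lam : ℝ) : ℂ) / ((Ψ lam : ℂ) - Ψp z)
      = ∫ α : ℝ, 2 * (α : ℂ) / ((α : ℂ) ^ 2 + z ^ 2) ∂γ := by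
  set F : ℂ → ℂ := fun z => ∫ α : ℝ, 2 * (α : ℂ) / ((α : ℂ) ^ 2 + z ^ 2) ∂γ with hF
  -- Denominators are cleared so that the identity theorem applies before Ψp(z) ≠ Ψ(λ) is known.
  set A : ℂ → ℂ := fun z => (F z * ((lam : ℂ) ^ 2 - z ^ 2) - 2 * (lam : ℂ)) *
    ((Ψ lam : ℂ) - Ψp z) + ((deriv Ψ lam : ℝ) : ℂ) * ((lam : ℂ) ^ 2 - z ^ 2) with hA
  have hopen : IsOpen {z : ℂ | 0 < z.re} := isOpen_lt continuous_const Complex.continuous_re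
  have hFd : DifferentiableOn ℂ F {z : ℂ | 0 < z.re} := differentiableOn_integral_two_mul_div
  have hAd : DifferentiableOn ℂ A {z : ℂ | 0 < z.re} := by fun_prop
  have hconv : Convex ℝ {z : ℂ | 0 < z.re} := convex_halfSpace_re_gt 0
  have hreal : ∀ ξ : ℝ, lam < ξ → A (ξ : ℂ) = 0 := by
    intro ξ hξ
    have hξ0 : 0 < ξ := hlam.trans hξ
    have h1 : F (ξ : ℂ) = ((thetaKernel Ψ lam ξ : ℝ) : ℂ) := by
      rw [hrep ξ hξ0 hξ.ne', ← integral_complex_ofReal]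
      refine integral_congr_ae (ae_of_all _ fun α => ?_)
      push_cast
      rfl
    have h2 := h.apply_ne hlam hξ0.le hξ.ne'
    have h3 : lam ^ 2 - ξ ^ 2 ≠ 0 := by
      intro h0
      exact hξ.ne' ((sq_eq_sq₀ hξ0.le hlam.le).1 (by linarith))
    have h4 : (thetaKernel Ψ lam ξ * (lam ^ 2 - ξ ^ 2) - 2 * lam) * (Ψ lam - Ψ ξ)
        + deriv Ψ lam * (lam ^ 2 - ξ ^ 2) = 0 := by
      rw [thetaKernel]
      field_simp
      ring
    simp only [hA]
    rw [h1, hext ξ hξ0]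
    exact_mod_cast h4
  -- A vanishes on the real ray (λ, ∞), so its zeros accumulate at 2λ.
  have hzero : EqOn A 0 {z : ℂ | 0 < z.re} := by
    refine (hAd.analyticOnNhd hopen).eqOn_zero_of_preconnected_of_frequently_eq_zero
      hconv.isPreconnected (z₀ := ((2 * lam : ℝ) : ℂ)) ?_ ?_
    · simpa using hlam
    · have hseq : Tendsto (fun n : ℕ => ((2 * lam + 1 / ((n : ℝ) + 1) : ℝ) : ℂ)) atTop
          (𝓝[≠] ((2 * lam : ℝ) : ℂ)) := by
        refine tendsto_nhdsWithin_iff.2 ⟨?_, Eventually.of_forall fun n => ?_⟩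
        · refine (Complex.continuous_ofReal.tendsto _).comp ?_
          simpa using tendsto_one_div_add_atTop_nhds_zero_nat.const_add (2 * lam)
        · rw [mem_compl_iff, mem_singleton_iff, Complex.ofReal_inj]
          have : 0 < 1 / ((n : ℝ) + 1) := by positivity
          linarith
      refine hseq.frequently (Frequently.of_forall fun n => hreal _ ?_)
      have : 0 < 1 / ((n : ℝ) + 1) := by positivity
      linarith
  have hAz : A z = 0 := hzero hz
  have hsq : (lam : ℂ) ^ 2 - z ^ 2 ≠ 0 := by
    intro h0
    rcases sq_eq_sq_iff_eq_or_eq_neg.1 (sub_eq_zero.1 h0) with h1 | h1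
    · exact hz' (by rw [← h1]; simp)
    · exact hz' (by rw [← neg_eq_iff_eq_neg.2 h1]; simp)
  have hD : ((deriv Ψ lam : ℝ) : ℂ) ≠ 0 := by
    exact_mod_cast (h.deriv_pos lam hlam).ne'
  -- Were this difference zero, A(z) would reduce to Ψ'(λ)(λ² - z²), which is nonzero off the real
  -- axis.
  have hne : (Ψ lam : ℂ) - Ψp z ≠ 0 := by
    intro h0
    simp only [hA, h0, mul_zero, zero_add] at hAz
    exact mul_ne_zero hD hsq hAz
  refine ⟨hne, ?_⟩
  change _ = F z
  simp only [hA] at hAz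
  field_simp
  linear_combination -hAz

/-- On the imaginary axis 2λ/(λ² - z²) is real, so only the term with Ψp contributes to the boundary
density. The condition `hne` is needed only on this axis, as in the open quadrant nonvanishing is
automatic. -/
theorem laplaceAbs_eq_of_extension (h : IsRegularExponent Ψ) (hlam : 0 < lam)
    (hγ : γ (Iic 0) = 0)
    (hrep : ∀ ξ, 0 < ξ → ξ ≠ lam → thetaKernel Ψ lam ξ = ∫ α, 2 * α / (α ^ 2 + ξ ^ 2) ∂γ)
    {Ψp : ℂ → ℂ} (hd : DifferentiableOn ℂ Ψp {z : ℂ | 0 < z.re})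
    (hc : ContinuousOn Ψp {z : ℂ | 0 ≤ z.re})
    (hext : ∀ ξ : ℝ, 0 < ξ → Ψp (ξ : ℂ) = (Ψ ξ : ℂ))
    (hne : ∀ ξ : ℝ, 0 < ξ → Ψp (Complex.I * (ξ : ℂ)) ≠ (Ψ lam : ℂ)) (x : ℝ) :
    IntegrableOn (fun ξ : ℝ =>
      (1 / ((Ψ lam : ℂ) - Ψp (Complex.I * (ξ : ℂ)))).im * Real.exp (-(ξ * |x|))) (Ioi 0) ∧
    laplaceAbs γ x = deriv Ψ lam / Real.pi * ∫ ξ in Ioi (0 : ℝ),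
      (1 / ((Ψ lam : ℂ) - Ψp (Complex.I * (ξ : ℂ)))).im * Real.exp (-(ξ * |x|)) := by
  set K : ℂ → ℂ := fun z =>
    2 * (lam : ℂ) / ((lam : ℂ) ^ 2 - z ^ 2) - ((deriv Ψ lam : ℝ) : ℂ) / ((Ψ lam : ℂ) - Ψp z) with hKdef
  have hKc : ContinuousOn K {z : ℂ | 0 ≤ z.re ∧ 0 < z.im} := by
    have hc' : ContinuousOn Ψp {z : ℂ | 0 ≤ z.re ∧ 0 < z.im} := hc.mono fun z hz => hz.1
    refine ContinuousOn.sub (ContinuousOn.div (by fun_prop) (by fun_prop) fun z hz h0 => ?_)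
      (ContinuousOn.div (by fun_prop) (by fun_prop) fun z hz => ?_)
    · have hz' : z.im ≠ 0 := hz.2.ne'
      rcases sq_eq_sq_iff_eq_or_eq_neg.1 (sub_eq_zero.1 h0) with h1 | h1
      · exact hz' (by rw [← h1]; simp)
      · exact hz' (by rw [← neg_eq_iff_eq_neg.2 h1]; simp)
    · rcases (show 0 ≤ z.re from hz.1).lt_or_eq with h1 | h1
      · exact (h.extension_kernel_eq hlam hrep hd hext h1 hz.2.ne').1
      · have h2 : z = Complex.I * (z.im : ℂ) := by
          apply Complex.ext <;> simp [← h1]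
        rw [h2]
        exact sub_ne_zero.2 (hne _ hz.2).symm
  obtain ⟨hi, heq⟩ := laplaceAbs_eq_integral_boundary hγ hKc
    (fun z hz hz' => (h.extension_kernel_eq hlam hrep hd hext hz hz'.ne').2) x
  have hv : ∀ η : ℝ, -(Real.pi⁻¹ * (K (Complex.I * (η : ℂ))).im)
      = deriv Ψ lam / Real.pi * (1 / ((Ψ lam : ℂ) - Ψp (Complex.I * (η : ℂ)))).im := by
    intro η
    have h1 : 2 * (lam : ℂ) / ((lam : ℂ) ^ 2 - (Complex.I * (η : ℂ)) ^ 2)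
        = ((2 * lam / (lam ^ 2 + η ^ 2) : ℝ) : ℂ) := by
      rw [mul_pow, Complex.I_sq]
      push_cast
      ring
    simp only [hKdef]
    rw [h1, Complex.sub_im, Complex.ofReal_im, ← mul_one_div, Complex.im_ofReal_mul]
    ring
  simp only [hv, mul_assoc] at hi heq
  rw [integral_const_mul] at heq
  refine ⟨?_, heq⟩
  have hD : deriv Ψ lam / Real.pi ≠ 0 :=
    div_ne_zero (h.deriv_pos lam hlam).ne' Real.pi_ne_zero
  exact (integrable_const_mul_iff (IsUnit.mk0 _ hD) _).1 hi

end IsRegularExponent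

end

theorem theorem1p4
    {Ω : Type*} [MeasurableSpace Ω] (P : Measure Ω) [IsProbabilityMeasure P]
    (X : ℝ≥0 → Ω → ℝ) (Ψ : ℝ → ℝ)
    (hX : IsLevyProcess X P) (hsymm : IsSymmetricProcess X P)
    (hΨ : IsLevyKhintchineExponent X P Ψ)
    (hpos : ∀ ξ : ℝ, 0 < ξ → 0 < deriv Ψ ξ)
    (hint : Integrable (fun ξ : ℝ => 1 / (1 + Ψ ξ)))
    (lam : ℝ) (hlam : 0 < lam) :
    -- part (a)
    ((∀ ξ : ℝ, 0 < ξ → DifferentiableAt ℝ (deriv Ψ) ξ) →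
      (∀ ξ : ℝ, 0 < ξ → 2 * ξ * deriv (deriv Ψ) ξ ≤ deriv Ψ ξ) →
        IntegrableOn (thetaKernel Ψ lam) (Ioi 0) ∧
        IsL2C0WithFourier (eigenG Ψ lam) (fourierG Ψ lam) ∧
        theta Ψ lam ∈ Ico 0 (Real.pi / 2) ∧
        (∀ x : ℝ, |eigenG Ψ lam x| ≤ eigenG Ψ lam 0) ∧
        eigenG Ψ lam 0 = Real.sin (theta Ψ lam)) ∧
    -- part (b)
    ((∃ ψ : ℝ → ℝ, IsCompleteBernstein ψ ∧ ∀ ξ : ℝ, 0 < ξ → Ψ ξ = ψ (ξ ^ 2)) →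
        IntegrableOn (thetaKernel Ψ lam) (Ioi 0) ∧
        IsL2C0WithFourier (eigenG Ψ lam) (fourierG Ψ lam) ∧
        theta Ψ lam ∈ Ico 0 (Real.pi / 2) ∧
        IsCompletelyMonotoneOnIci (eigenG Ψ lam) ∧
        (∃ γ : Measure ℝ, IsFiniteMeasure γ ∧ γ (Iio 0) = 0 ∧
          ∀ x : ℝ, eigenG Ψ lam x = ∫ ξ, Real.exp (-(ξ * |x|)) ∂γ) ∧
        (∀ x : ℝ, 0 ≤ eigenG Ψ lam x) ∧
        Integrable (eigenG Ψ lam) ∧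
        (∫ x : ℝ, eigenG Ψ lam x) = fourierG Ψ lam 0 ∧
        fourierG Ψ lam 0 = 2 * Real.cos (theta Ψ lam) / lam *
          (1 - lam * deriv Ψ lam / (2 * Ψ lam)) ∧
        -- explicit formula under the holomorphic extension hypothesis
        (∀ Ψp : ℂ → ℂ,
          DifferentiableOn ℂ Ψp {z : ℂ | 0 < z.re} →
          ContinuousOn Ψp {z : ℂ | 0 ≤ z.re} →
          (∀ ξ : ℝ, 0 < ξ → Ψp (ξ : ℂ) = (Ψ ξ : ℂ)) →
          (∀ ξ : ℝ, 0 < ξ → Ψp (Complex.I * (ξ : ℂ)) ≠ (Ψ lam : ℂ)) →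
          ∀ x : ℝ,
            IntegrableOn (fun ξ : ℝ =>
              (1 / ((Ψ lam : ℂ) - Ψp (Complex.I * (ξ : ℂ)))).im * Real.exp (-(ξ * |x|)))
              (Ioi 0) ∧
            eigenG Ψ lam x = deriv Ψ lam * Real.cos (theta Ψ lam) / Real.pi *
              ∫ ξ in Ioi (0 : ℝ),
                (1 / ((Ψ lam : ℂ) - Ψp (Complex.I * (ξ : ℂ)))).im *
                  Real.exp (-(ξ * |x|)))) := by
  have h : IsRegularExponent Ψ := hΨ.isRegularExponent (hX.measurable 1) hpos hint
  refine ⟨fun hd hle => ?_, fun ⟨ψ, hψ, hΨψ⟩ => ?_⟩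
  · obtain ⟨hbdd, hKint⟩ :=
      h.exists_bound_thetaKernel hlam (h.eventually_bound_thetaKernel hlam (hd lam hlam))
    have hnonneg := h.thetaKernel_nonneg hlam (h.antitoneOn_deriv_div hd hle)
    exact ⟨hKint.integrableOn, h.isL2C0WithFourier_eigenG hbdd hKint,
      IsRegularExponent.theta_mem_Ico fun ξ _ => hnonneg ξ,
      abs_invFourierRe_le fun ξ => mul_nonneg (cos_theta_pos Ψ lam).le (hnonneg ξ), h.eigenG_zero⟩
  · obtain ⟨hbdd, hKint, γ₀, hfin₀, hγ₀, hinv₀, hrep₀⟩ := h.exists_measure_thetaKernel hlam hψ hΨψ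
    -- `γ₀` represents the bare kernel and is the measure used for the explicit formula. Scaling by
    -- cos ϑ > 0 gives the measure of G.
    set q : ℝ≥0 := (Real.cos (theta Ψ lam)).toNNReal with hq
    have hq' : (q : ℝ) = Real.cos (theta Ψ lam) := Real.coe_toNNReal _ (cos_theta_pos Ψ lam).le
    set γ : Measure ℝ := q • γ₀ with hγdef
    have hγ : γ (Iic 0) = 0 := by
      rw [hγdef, Measure.smul_apply, hγ₀, smul_zero]
    have hinv : Integrable (fun α => 2 / α) γ := hinv₀.smul_measure_nnreal
    have hrep : ∀ ξ, 0 < ξ → ξ ≠ lam →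
        fourierG Ψ lam ξ = ∫ α, 2 * α / (α ^ 2 + ξ ^ 2) ∂γ := by
      intro ξ hξ hne
      rw [hγdef, integral_smul_nnreal_measure, NNReal.smul_def, hq', smul_eq_mul, fourierG,
        hrep₀ ξ hξ hne]
    have hG := h.eigenG_eq_laplaceAbs hKint hγ hinv hrep
    refine ⟨hKint.integrableOn, h.isL2C0WithFourier_eigenG hbdd hKint,
      IsRegularExponent.theta_mem_Ico fun ξ hξ => ?_, ?_, ⟨γ, inferInstance, ?_, ?_⟩, ?_, ?_, ?_,
      h.fourierG_zero hlam, fun Ψp hd hc hext hne x => ?_⟩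
    -- The mixture formula omits ξ = λ, where the kernel has the default value 0.
    · by_cases hne : ξ = lam
      · rw [hne, IsRegularExponent.thetaKernel_self]
      · rw [hrep₀ ξ hξ hne]
        refine integral_nonneg_of_ae ?_
        filter_upwards [ae_pos_of_measure_Iic hγ₀] with α hα
        simp only [Pi.zero_apply]
        positivity
    · rw [hG]
      exact isCompletelyMonotoneOnIci_laplaceAbs hγ
    · exact measure_mono_null Iio_subset_Iic_self hγ
    · intro x
      rw [hG]
      rfl
    · rw [hG]
      exact laplaceAbs_nonneg
    · rw [hG]
      exact integrable_laplaceAbs hγ hinv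
    · rw [hG]
      exact h.integral_laplaceAbs_eq_fourierG_zero hlam hγ hinv hrep
    · obtain ⟨hi, heq⟩ := h.laplaceAbs_eq_of_extension hlam hγ₀ hrep₀ hd hc hext hne x
      refine ⟨hi, ?_⟩
      have h1 : laplaceAbs γ x = Real.cos (theta Ψ lam) * laplaceAbs γ₀ x := by
        rw [laplaceAbs, hγdef, integral_smul_nnreal_measure, NNReal.smul_def, hq', smul_eq_mul]
        rfl
      rw [hG, h1, heq]
      ring
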